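/- **Setting.** Values are natural numbers ($0=\mathsf{null}$); locations are $\mathit{Lock}$, $q.\mathit{locked}$, $q.\mathit{next}$ for each value $q$, and a location $f$ used only for fences; all are initially $0$. Let $a\neq b$ be nonzero values (node addresses). The MCS-lock client has two threads; the first takes $n=a$, the second $n=b$, and each runs $\mathit{lock}(n);\mathit{unlock}(n)$, where - $\mathit{lock}(n)$: $n.\mathit{locked}:=1$; $n.\mathit{next}:=\mathsf{null}$; $\big[\mathsf{fence}^{\mathsf{rel}}\big]$; $\mathit{pred}:=\mathsf{SWAP}^{\mathsf{acqrel}}(\mathit{Lock},n)$; if $\mathit{pred}\neq\mathsf{null}$ then $\{\mathit{pred}.\mathit{next}:=n$; while $n.\mathit{locked}=1$ do $\{\}$; $\mathsf{fence}^{\mathsf{acq}}\}$. - $\mathit{unlock}(n)$: $\mathsf{fence}^{\mathsf{rel}}$; $\mathit{succ}:=n.\mathit{next}$; $\mathsf{fence}^{\mathsf{acq}}$; if $\mathit{succ}=\mathsf{null}$ then $\{$if $\mathsf{CAS}^{\mathsf{acqrel}}(\mathit{Lock},n,\mathsf{null})$ succeeds then return; repeat $\mathit{succ}:=n.\mathit{next}$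 until $\mathit{succ}\neq\mathsf{null}\}$; $\mathit{succ}.\mathit{locked}:=0$. Unannotated accesses are relaxed, the CAS is strong, and a failed $\mathsf{CAS}^{\mathsf{acqrel}}$ is an acquire read. The bracketed fence is the one missing in the published algorithm. A *behavior* $\beta$ assigns to each thread the finite or infinite sequence of labels (reads $\mathtt R$, writes $\mathtt W$, read-modify-writes $\mathtt{RMW}$, fences $\mathtt F$) of its steps; it is *finite* if both sequences are. At program level a read may return any value. A run of the interleaving semantics is *thread-fair* if it is finite or if every thread that is enabled from some index on is scheduled at or after that index; a behavior is thread-fair if a thread-fair run induces it. An *execution graph* $G=(E,\mathit{rf},\mathit{mo})$ consists of a well-formed set $E$ of events (one initialization write per location; each thread's events numbered consecutively from $0$, with one label per number), a reads-from relation $\mathit{rf}$ giving each read exactly one write of the same location and value, and a modification order $\mathit{mo}$, a disjoint union of strict total orders on the writes to each location (an RMW is both a read and a write). Let $\mathit{po}$ be program order (initialization events first), $\mathit{fr}=(\mathit{rf}^{-1};\mathit{mo})\setminus\mathrm{id}$, and for a relation $R$ let $R|_{\mathrm{loc}}$ be its restriction to pairs of events on the same location and $R|_{\neq\mathrm{loc}}=R\setminus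 R|_{\mathrm{loc}}$. $G$ is *fair* if every event has only finitely many $\mathit{mo}$- and $\mathit{fr}$-predecessors. Consistency of $G$: - SC: $(\mathit{po}\cup\mathit{rf}\cup\mathit{mo}\cup\mathit{fr})^+$ is irreflexive. - TSO: $(\mathit{ppo}\cup\mathit{rfe}\cup\mathit{mo}\cup\mathit{fr})^+$ and $(\mathit{po}|_{\mathrm{loc}}\cup\mathit{rf}\cup\mathit{mo}\cup\mathit{fr})^+$ are irreflexive, where $\mathit{rfe}=\mathit{rf}\setminus\mathit{po}$ and $\mathit{ppo}$ is $\mathit{po}$ without the pairs from a non-RMW write to a non-RMW read. - RA: $\big((\mathit{po}\cup\mathit{rf})^+|_{\mathrm{loc}}\cup\mathit{rf}\cup\mathit{mo}\cup\mathit{fr}\big)^+$ is irreflexive. - RC11 (Lahav et al., PLDI 2017, with each RMW a single event): $\mathit{hb};\mathit{eco}^?$, $\mathit{eco}$, $\mathit{psc}^+$ and $(\mathit{po}\cup\mathit{rf})^+$ are irreflexive, where $\mathit{eco}=(\mathit{rf}\cup\mathit{mo}\cup\mathit{fr})^+$, $\mathit{hb}=(\mathit{po}\cup\mathit{sw})^+$,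 $\mathit{sw}=[E^{\sqsupseteq\mathsf{rel}}];([\mathtt F];\mathit{po})^?;\mathit{rs};\mathit{rf};[\mathtt R^{\sqsupseteq\mathsf{rlx}}];(\mathit{po};[\mathtt F])^?;[E^{\sqsupseteq\mathsf{acq}}]$, $\mathit{rs}=[\mathtt W];(\mathit{po}|_{\mathrm{loc}})^?;[\mathtt W^{\sqsupseteq\mathsf{rlx}}];(\mathit{rf};[\mathtt{RMW}])^*$, and $\mathit{psc}=([E^{\mathsf{sc}}]\cup[\mathtt F^{\mathsf{sc}}];\mathit{hb}^?);\mathit{scb};([E^{\mathsf{sc}}]\cup\mathit{hb}^?;[\mathtt F^{\mathsf{sc}}])\ \cup\ [\mathtt F^{\mathsf{sc}}];(\mathit{hb}\cup\mathit{hb};\mathit{eco};\mathit{hb});[\mathtt F^{\mathsf{sc}}]$ with $\mathit{scb}=\mathit{po}\cup\mathit{po}|_{\neq\mathrm{loc}};\mathit{hb};\mathit{po}|_{\neq\mathrm{loc}}\cup\mathit{hb}|_{\mathrm{loc}}\cup\mathit{mo}\cup\mathit{fr}$. For $X\in\{\mathrm{SC},\mathrm{TSO},\mathrm{RA},\mathrm{RC11}\}$,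 a behavior $\beta$ is allowed by *fair $X$* if the events of $\beta$, together with the initialization events, are the event set of some fair $X$-consistent execution graph. In SC, TSO and RA, labels have no modes and no fences: modes are dropped, and a fence is either an RMW of $f$ writing back the value it reads, or no operation. **Theorem.** 1. With the bracketed $\mathsf{fence}^{\mathsf{rel}}$ present, every thread-fair behavior of the client that is allowed by fair SC, by fair TSO, by fair RA (under either treatment of fences), or by fair RC11 is finite. 2. Without the bracketed fence, some thread-fair behavior of the client that is allowed by fair RC11 is infinite. -/

import Mathlib

namespace FairMem

/-! ### Values, locations, threads, event labels -/

/-- Values.  `0` is the initial value of every location and also plays the role of `null`;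
the address of a queue node is a nonzero value. -/
abbrev Val : Type := ℕ

/-- Shared locations: the lock variable `Lock`, the fields `q.locked` and `q.next` of the queue
node with address `q`, and a distinguished location used for nothing but fences. -/
inductive Loc : Type
  | lock
  | locked (q : Val)
  | next (q : Val)
  | fenceLoc

/-- The two threads. -/
abbrev Tid : Type := Fin 2

/-- Event labels: reads, writes and read-modify-writes carrying an access annotation from `Acc`,
and fences carrying an annotation from `Fen`. -/
inductive Lab (Acc Fen : Type) : Type
  | R (o : Acc) (x : Loc) (v : Val)
  | W (o : Acc) (x : Loc) (v : Val)
  | U (o : Acc) (x : Loc) (vr vw : Val)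
  | F (o : Fen)

/-- Plain labels: no access modes and no fences. -/
abbrev ELab : Type := Lab Unit Empty

/-- C11 access modes (memory orders). -/
inductive Mode : Type
  | na | rlx | acq | rel | acqrel | sc

/-- Labels with C11 access modes and C11 fences. -/
abbrev CLab : Type := Lab Mode Mode

namespace Lab

variable {Acc Fen : Type}

def loc : Lab Acc Fen → Option Loc
  | R _ x _ => some x
  | W _ x _ => some x
  | U _ x _ _ => some x
  | F _ => none

def valr : Lab Acc Fen → Option Val
  | R _ _ v => some v
  | W _ _ _ => none
  | U _ _ v _ => some v
  | F _ => none

def valw : Lab Acc Fen → Option Val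
  | R _ _ _ => none
  | W _ _ v => some v
  | U _ _ _ v => some v
  | F _ => none

end Lab

/-! ### Labeled transition systems and programs -/

/-- Labeled transition systems with observable labels in `A` and no silent labels. -/
structure LTS (A : Type) where
  Q : Type
  init : Q
  step : Q → A → Q → Prop

/-- `μ`, a finite or infinite sequence of transitions (source, label, target), is a run. -/
structure LTS.IsRun {A : Type} (S : LTS A) (μ : Stream'.Seq (S.Q × A × S.Q)) : Prop where
  trans : ∀ k t, μ.get? k = some t → S.step t.1 t.2.1 t.2.2
  start : ∀ t, μ.get? 0 = some t → t.1 = S.init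
  chain : ∀ k t t', μ.get? k = some t → μ.get? (k + 1) = some t' → t.2.2 = t'.1

/-- A concurrent program: one sequential program per thread. -/
abbrev Program (Acc Fen : Type) : Type 1 := Tid → LTS (Lab Acc Fen)

/-- The interleaving semantics of a concurrent program. -/
def Program.lts {Acc Fen : Type} (P : Program Acc Fen) : LTS (Tid × Lab Acc Fen) where
  Q := ∀ τ, (P τ).Q
  init := fun τ => (P τ).init
  step := fun p σ p' =>
    (P σ.1).step (p σ.1) σ.2 (p' σ.1) ∧ ∀ π, π ≠ σ.1 → p' π = p π

/-- Thread `τ` is enabled in the state `p`. -/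
def Program.Enabled {Acc Fen : Type} (P : Program Acc Fen) (τ : Tid) (p : P.lts.Q) : Prop :=
  ∃ l p', P.lts.step p (τ, l) p'

/-- A run is thread-fair if it is finite or every thread that is continuously enabled from some
index on is scheduled at or after that index. -/
def Program.ThreadFair {Acc Fen : Type} (P : Program Acc Fen)
    (μ : Stream'.Seq (P.lts.Q × (Tid × Lab Acc Fen) × P.lts.Q)) : Prop :=
  μ.Terminates ∨
    ∀ τ k, (∀ j, k ≤ j → ∀ t, μ.get? j = some t → P.Enabled τ t.1) →
      ∃ j, k ≤ j ∧ ∃ t, μ.get? j = some t ∧ t.2.1.1 = τ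

/-- Behaviors: a finite or infinite sequential trace for every thread. -/
abbrev Behavior (Acc Fen : Type) : Type := Tid → Stream'.Seq (Lab Acc Fen)

/-- A behavior is finite if it assigns a finite trace to every thread. -/
def Behavior.Finite {Acc Fen : Type} (β : Behavior Acc Fen) : Prop :=
  ∀ τ, (β τ).Terminates

/-- `β` is the behavior induced by the concurrent trace `ρ`: the `k`-th label of `β τ` is the label
of the position of `ρ` that belongs to `τ` and has exactly `k` positions of `τ` before it. -/
def Induces {Acc Fen : Type} (ρ : Stream'.Seq (Tid × Lab Acc Fen)) (β : Behavior Acc Fen) :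
    Prop :=
  ∀ τ k l, (β τ).get? k = some l ↔
    ∃ j, ρ.get? j = some (τ, l) ∧ {i | i < j ∧ ∃ l', ρ.get? i = some (τ, l')}.ncard = k

/-- The thread-fair behaviors of a program. -/
def Program.behTF {Acc Fen : Type} (P : Program Acc Fen) : Set (Behavior Acc Fen) :=
  {β | ∃ μ, P.lts.IsRun μ ∧ P.ThreadFair μ ∧ Induces (μ.map fun t => t.2.1) β}

/-! ### Events and execution graphs -/

/-- Events: the initialization write of `0` to `x`, and the event with serial number `k` and
label `l` in thread `τ`. -/
inductive Event (Acc Fen : Type) : Type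
  | init (x : Loc)
  | act (k : ℕ) (τ : Tid) (l : Lab Acc Fen)

namespace Event

variable {Acc Fen : Type}

def loc : Event Acc Fen → Option Loc
  | init x => some x
  | act _ _ l => l.loc

def valr : Event Acc Fen → Option Val
  | init _ => none
  | act _ _ l => l.valr

def valw : Event Acc Fen → Option Val
  | init _ => some 0
  | act _ _ l => l.valw

/-- Reads, including read-modify-writes. -/
def IsR : Event Acc Fen → Prop
  | act _ _ (.R _ _ _) => True
  | act _ _ (.U _ _ _ _) => True
  | _ => False

/-- Writes, including read-modify-writes and initialization events. -/
def IsW : Event Acc Fen → Prop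
  | init _ => True
  | act _ _ (.W _ _ _) => True
  | act _ _ (.U _ _ _ _) => True
  | _ => False

/-- Read-modify-writes. -/
def IsU : Event Acc Fen → Prop
  | act _ _ (.U _ _ _ _) => True
  | _ => False

/-- Fences. -/
def IsF : Event Acc Fen → Prop
  | act _ _ (.F _) => True
  | _ => False

/-- The sequenced-before order. -/
def SB : Event Acc Fen → Event Acc Fen → Prop
  | init _, act _ _ _ => True
  | act j τ _, act k π _ => τ = π ∧ j < k
  | _, _ => False

end Event

/-- The set of events extracted from a behavior. -/
def Behavior.events {Acc Fen : Type} (β : Behavior Acc Fen) : Set (Event Acc Fen) :=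
  {e | (∃ x, e = .init x) ∨ ∃ k τ l, (β τ).get? k = some l ∧ e = .act k τ l}

/-- Execution graphs. -/
structure ExecGraph (Acc Fen : Type) where
  /-- the events -/
  E : Set (Event Acc Fen)
  /-- reads-from -/
  rf : Event Acc Fen → Event Acc Fen → Prop
  /-- modification order -/
  mo : Event Acc Fen → Event Acc Fen → Prop
  init_mem : ∀ x, .init x ∈ E
  sn_unique : ∀ k τ l l', .act k τ l ∈ E → .act k τ l' ∈ E → l = l'
  sn_closed : ∀ k τ l, .act k τ l ∈ E → ∀ j, j < k → ∃ l', .act j τ l' ∈ E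
  rf_dom : ∀ w r, rf w r → w ∈ E ∧ r ∈ E ∧ w.IsW ∧ r.IsR ∧ w.loc = r.loc ∧ w.valw = r.valr
  rf_functional : ∀ w w' r, rf w r → rf w' r → w = w'
  rf_total : ∀ r ∈ E, r.IsR → ∃ w, rf w r
  mo_dom : ∀ w w', mo w w' → w ∈ E ∧ w' ∈ E ∧ w.IsW ∧ w'.IsW ∧ w.loc = w'.loc
  mo_irrefl : ∀ w, ¬ mo w w
  mo_trans : ∀ w₁ w₂ w₃, mo w₁ w₂ → mo w₂ w₃ → mo w₁ w₃
  mo_total : ∀ w ∈ E, ∀ w' ∈ E, w.IsW → w'.IsW → w.loc = w'.loc → w ≠ w' → mo w w' ∨ mo w' w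

/-- The identity relation on a set of events. -/
def idOn {α : Type} (S : α → Prop) (x y : α) : Prop := x = y ∧ S x

/-- Restriction of a relation to pairs of events of the same location. -/
def sameLoc {Acc Fen : Type} (r : Event Acc Fen → Event Acc Fen → Prop)
    (e e' : Event Acc Fen) : Prop :=
  r e e' ∧ ∃ x, e.loc = some x ∧ e'.loc = some x

/-- The pairs of a relation that are not on the same location. -/
def diffLoc {Acc Fen : Type} (r : Event Acc Fen → Event Acc Fen → Prop)
    (e e' : Event Acc Fen) : Prop :=
  r e e' ∧ ¬ ∃ x, e.loc = some x ∧ e'.loc = some x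

/-- Irreflexivity of a relation. -/
def Irrefl {α : Type} (r : α → α → Prop) : Prop := ∀ x, ¬ r x x

namespace ExecGraph

open Relation

section Common

variable {Acc Fen : Type} (G : ExecGraph Acc Fen)

/-- Program order. -/
def po (e e' : Event Acc Fen) : Prop := e ∈ G.E ∧ e' ∈ G.E ∧ e.SB e'

/-- From-read: `rf⁻¹ ; mo` minus the identity. -/
def fr (r w : Event Acc Fen) : Prop := (∃ w', G.rf w' r ∧ G.mo w' w) ∧ r ≠ w

/-- Fairness: `mo` and `fr` are prefix-finite. -/
def Fair : Prop :=
  (∀ e ∈ G.E, {e' | G.mo e' e}.Finite) ∧ (∀ e ∈ G.E, {e' | G.fr e' e}.Finite)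

end Common

section Plain

variable (G : ExecGraph Unit Empty)

/-- SC consistency. -/
def SC : Prop :=
  Irrefl (TransGen fun e e' => G.po e e' ∨ G.rf e e' ∨ G.mo e e' ∨ G.fr e e')

/-- External reads-from. -/
def rfe (e e' : Event Unit Empty) : Prop := G.rf e e' ∧ ¬ G.po e e'

/-- Preserved program order of TSO. -/
def ppo (e e' : Event Unit Empty) : Prop :=
  G.po e e' ∧ ¬ ((e.IsW ∧ ¬ e.IsU) ∧ (e'.IsR ∧ ¬ e'.IsU))

/-- TSO consistency: irreflexivity of TSO-happens-before and SC per location. -/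
def TSO : Prop :=
  Irrefl (TransGen fun e e' => G.ppo e e' ∨ G.rfe e e' ∨ G.mo e e' ∨ G.fr e e') ∧
  Irrefl (TransGen fun e e' => sameLoc G.po e e' ∨ G.rf e e' ∨ G.mo e e' ∨ G.fr e e')

/-- RA-happens-before. -/
def hbRA : Event Unit Empty → Event Unit Empty → Prop :=
  TransGen fun e e' => G.po e e' ∨ G.rf e e'

/-- RA consistency. -/
def RA : Prop :=
  Irrefl (TransGen fun e e' => sameLoc G.hbRA e e' ∨ G.rf e e' ∨ G.mo e e' ∨ G.fr e e')

end Plain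

end ExecGraph

/-! ### RC11 -/

/-- Modes at least as strong as `rlx`. -/
def Mode.AtLeastRlx (o : Mode) : Prop := o ≠ .na

/-- Modes at least as strong as `acq`. -/
def Mode.AtLeastAcq (o : Mode) : Prop := o = .acq ∨ o = .acqrel ∨ o = .sc

/-- Modes at least as strong as `rel`. -/
def Mode.AtLeastRel (o : Mode) : Prop := o = .rel ∨ o = .acqrel ∨ o = .sc

/-- The mode of an event; initialization writes are non-atomic. -/
def Event.mode : Event Mode Mode → Mode
  | .init _ => .na
  | .act _ _ (.R o _ _) => o
  | .act _ _ (.W o _ _) => o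
  | .act _ _ (.U o _ _ _) => o
  | .act _ _ (.F o) => o

namespace ExecGraph

open Relation

section RC11

variable (G : ExecGraph Mode Mode)

/-- Release sequences: `[W] ; (po|loc)? ; [W⊒rlx] ; (rf ; [RMW])*`. -/
def rs : Event Mode Mode → Event Mode Mode → Prop :=
  Comp (idOn Event.IsW) <| Comp (ReflGen (sameLoc G.po)) <|
    Comp (idOn fun e => e.IsW ∧ e.mode.AtLeastRlx) <|
      ReflTransGen (Comp G.rf (idOn Event.IsU))

/-- Synchronizes-with:
`[E⊒rel] ; ([F] ; po)? ; rs ; rf ; [R⊒rlx] ; (po ; [F])? ; [E⊒acq]`. -/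
def sw : Event Mode Mode → Event Mode Mode → Prop :=
  Comp (idOn fun e => e.mode.AtLeastRel) <| Comp (ReflGen (Comp (idOn Event.IsF) G.po)) <|
    Comp G.rs <| Comp G.rf <| Comp (idOn fun e => e.IsR ∧ e.mode.AtLeastRlx) <|
      Comp (ReflGen (Comp G.po (idOn Event.IsF))) (idOn fun e => e.mode.AtLeastAcq)

/-- Happens-before: `(po ∪ sw)⁺`. -/
def hb : Event Mode Mode → Event Mode Mode → Prop :=
  TransGen fun e e' => G.po e e' ∨ G.sw e e'

/-- Extended coherence order: `(rf ∪ mo ∪ fr)⁺`. -/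
def eco : Event Mode Mode → Event Mode Mode → Prop :=
  TransGen fun e e' => G.rf e e' ∨ G.mo e e' ∨ G.fr e e'

/-- SC-before: `po ∪ po|≠loc ; hb ; po|≠loc ∪ hb|loc ∪ mo ∪ fr`. -/
def scb (e e' : Event Mode Mode) : Prop :=
  G.po e e' ∨ Comp (diffLoc G.po) (Comp G.hb (diffLoc G.po)) e e' ∨ sameLoc G.hb e e' ∨
    G.mo e e' ∨ G.fr e e'

/-- `[Esc] ∪ [Fsc] ; hb?`. -/
def scLeft (e e' : Event Mode Mode) : Prop :=
  idOn (fun d => d.mode = .sc) e e' ∨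
    Comp (idOn fun d => d.IsF ∧ d.mode = .sc) (ReflGen G.hb) e e'

/-- `[Esc] ∪ hb? ; [Fsc]`. -/
def scRight (e e' : Event Mode Mode) : Prop :=
  idOn (fun d => d.mode = .sc) e e' ∨
    Comp (ReflGen G.hb) (idOn fun d => d.IsF ∧ d.mode = .sc) e e'

/-- `([Esc] ∪ [Fsc] ; hb?) ; scb ; ([Esc] ∪ hb? ; [Fsc])`. -/
def pscBase : Event Mode Mode → Event Mode Mode → Prop :=
  Comp G.scLeft (Comp G.scb G.scRight)

/-- `[Fsc] ; (hb ∪ hb ; eco ; hb) ; [Fsc]`. -/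
def pscF : Event Mode Mode → Event Mode Mode → Prop :=
  Comp (idOn fun d => d.IsF ∧ d.mode = .sc) <|
    Comp (fun e e' => G.hb e e' ∨ Comp G.hb (Comp G.eco G.hb) e e')
      (idOn fun d => d.IsF ∧ d.mode = .sc)

/-- RC11 consistency, with a read-modify-write represented by a single event.  With single events,
atomicity (`fr ; mo` irreflexive), and the coherence of the two halves of a read-modify-write with
each other, are expressed by the irreflexivity of `eco`. -/
structure RC11 : Prop where
  coherence : Irrefl (Comp G.hb (ReflGen G.eco))
  atomicity : Irrefl G.eco
  sc_order : Irrefl (TransGen fun e e' => G.pscBase e e' ∨ G.pscF e e')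
  no_thin_air : Irrefl (TransGen fun e e' => G.po e e' ∨ G.rf e e')

end RC11

end ExecGraph

/-- The behaviors allowed by the declarative memory system `{G | C G}`. -/
def behDecl {Acc Fen : Type} (C : ExecGraph Acc Fen → Prop) : Set (Behavior Acc Fen) :=
  {β | ∃ G : ExecGraph Acc Fen, C G ∧ β.events = G.E}

/-! ### The MCS lock client -/

/-- Program points of a thread that allocates a node `n`, calls `lock(Lock, n)` and then
`unlock(Lock, n)`; local variables that are still needed are recorded in the state. -/
inductive PC : Type
  /-- `n.locked := 1` -/
  | setLocked
  /-- `n.next := null` -/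
  | clearNext
  /-- `fence^rel` (the fence in question) -/
  | lockFenceRel
  /-- `pred := SWAP^acqrel(Lock, n)` -/
  | swap
  /-- `pred.next := n` -/
  | link (pred : Val)
  /-- `while n.locked = 1 {}` -/
  | spin
  /-- `fence^acq` -/
  | lockFenceAcq
  /-- `unlock`: `fence^rel` -/
  | unlockFenceRel
  /-- `succ := n.next` -/
  | readNext
  /-- `fence^acq` -/
  | unlockFenceAcq (succ : Val)
  /-- `if CAS^acqrel(Lock, n, null) then return` -/
  | cas
  /-- `repeat succ := n.next until succ ≠ null` -/
  | awaitNext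
  /-- `succ.locked := 0` -/
  | handOver (succ : Val)
  | done

/-- The steps of such a thread; `fenced` says whether the release fence in `lock` is present.
Accesses without annotation are relaxed.  The CAS is strong; a failed `CAS^acqrel` is an acquire
read. -/
inductive Step (fenced : Bool) (n : Val) : PC → CLab → PC → Prop
  | setLocked : Step fenced n .setLocked (.W .rlx (.locked n) 1) .clearNext
  | clearNext : Step fenced n .clearNext (.W .rlx (.next n) 0)
      (if fenced then .lockFenceRel else .swap)
  | lockFenceRel : Step fenced n .lockFenceRel (.F .rel) .swap
  | swap (pred : Val) : Step fenced n .swap (.U .acqrel .lock pred n)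
      (if pred = 0 then .unlockFenceRel else .link pred)
  | link (pred : Val) : Step fenced n (.link pred) (.W .rlx (.next pred) n) .spin
  | spin (v : Val) : Step fenced n .spin (.R .rlx (.locked n) v)
      (if v = 1 then .spin else .lockFenceAcq)
  | lockFenceAcq : Step fenced n .lockFenceAcq (.F .acq) .unlockFenceRel
  | unlockFenceRel : Step fenced n .unlockFenceRel (.F .rel) .readNext
  | readNext (succ : Val) : Step fenced n .readNext (.R .rlx (.next n) succ) (.unlockFenceAcq succ)
  | unlockFenceAcq (succ : Val) : Step fenced n (.unlockFenceAcq succ) (.F .acq)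
      (if succ = 0 then .cas else .handOver succ)
  | casSuccess : Step fenced n .cas (.U .acqrel .lock n 0) .done
  | casFail (v : Val) (hv : v ≠ n) : Step fenced n .cas (.R .acq .lock v) .awaitNext
  | awaitNext (succ : Val) : Step fenced n .awaitNext (.R .rlx (.next n) succ)
      (if succ = 0 then .awaitNext else .handOver succ)
  | handOver (succ : Val) : Step fenced n (.handOver succ) (.W .rlx (.locked succ) 0) .done

/-- The two-thread client: thread 0 allocates its node at address `a`, thread 1 at address `b`;
each locks and then unlocks once. -/
def mcsClient (fenced : Bool) (a b : Val) : Program Mode Mode := fun τ =>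
  { Q := PC, init := .setLocked, step := Step fenced (if τ = 0 then a else b) }

/-- The two readings of a fence in a memory model whose labels have no fences: a read-modify-write
of the distinguished location that writes back the value it reads, or no operation at all. -/
inductive FenceReading : Type
  | rmw
  | nop

/-- Forget the access mode of a memory access; undefined on fences. -/
def CLab.forget : CLab → Option ELab
  | .R _ x v => some (.R () x v)
  | .W _ x v => some (.W () x v)
  | .U _ x vr vw => some (.U () x vr vw)
  | .F _ => none

/-- A sequential program without modes and fences obtained from one with modes and fences.  Under
the reading `nop`, the fences that precede a memory access are passed silently together with that
access. -/
def plainLTS : FenceReading → LTS CLab → LTS ELab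
  | .rmw, S =>
    { Q := S.Q
      init := S.init
      step := fun q l q' =>
        (∃ c, S.step q c q' ∧ c.forget = some l) ∨
          ∃ o v, S.step q (.F o) q' ∧ l = .U () .fenceLoc v v }
  | .nop, S =>
    { Q := S.Q
      init := S.init
      step := fun q l q' =>
        ∃ q₁ c, Relation.ReflTransGen (fun p p' => ∃ o, S.step p (.F o) p') q q₁ ∧
          S.step q₁ c q' ∧ c.forget = some l }

/-- The plain version of a concurrent program. -/
def Program.plain (i : FenceReading) (P : Program Mode Mode) : Program Unit Empty :=
  fun τ => plainLTS i (P τ)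

end FairMem

/-!
A thread of the client that runs forever stays forever in one of its two loops. The read of the
loop is then issued infinitely often from one location; by fairness all but finitely many of these
reads read the `mo`-maximal write to it, so it suffices that this write has the value that ends the
loop. A thread that waits for its successor is served by the thread that swapped after it, and that
write to `next` is `mo`-after its initialization by coherence. A thread that waits for the lock is
served by its predecessor, whose write to `locked` must be `mo`-after the waiting thread's own
`locked := 1`. In SC, TSO and RA this holds because reads-from is part of happens-before; in RC11
because the release fence of `lock` synchronizes with the acquire fence of `unlock`, or, if the
predecessor reads its successor only after a failed CAS, because that CAS acquires from the waiting
thread's access to the lock. Without the release fence the two writes to `locked` may be unordered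
by happens-before, and the modification order may place the hand-over first, so that the waiting
thread reads `1` forever.
-/

namespace FairMem

open Relation

/-! ### Local states along fair runs -/

section Runs

variable {Acc Fen : Type}

theorem LTS.IsRun.exists_states {A : Type} {S : LTS A} {μ : Stream'.Seq (S.Q × A × S.Q)}
    (hrun : S.IsRun μ) (hμ : ¬ μ.Terminates) :
    ∃ (st : ℕ → S.Q) (lab : ℕ → A), st 0 = S.init ∧
      ∀ j, μ.get? j = some (st j, lab j, st (j + 1)) := by
  choose t ht using fun j => Option.ne_none_iff_exists'.mp fun h => hμ ⟨j, h⟩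
  refine ⟨fun j => (t j).1, fun j => (t j).2.1, hrun.start _ (ht 0), fun j => ?_⟩
  rw [ht j]
  exact congrArg (fun q => some ((t j).1, (t j).2.1, q)) (hrun.chain j _ _ (ht j) (ht (j + 1)))

theorem ncard_setOf_lt_and_eq_count (p : ℕ → Prop) [DecidablePred p] (j : ℕ) :
    {i | i < j ∧ p i}.ncard = Nat.count p j := by
  rw [Nat.count_eq_card_filter_range, ← Set.ncard_coe_finset]
  congr 1
  ext i
  simp

theorem Induces.finite {ρ : Stream'.Seq (Tid × Lab Acc Fen)} {β : Behavior Acc Fen}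
    (h : Induces ρ β) (hρ : ρ.Terminates) : β.Finite := by
  obtain ⟨N, hN⟩ := hρ
  refine fun τ => ⟨N, by_contra fun hne => ?_⟩
  obtain ⟨l, hl⟩ := Option.ne_none_iff_exists'.mp hne
  obtain ⟨j, hj, hcard⟩ := (h τ N l).mp hl
  have hjN : j < N := by
    by_contra hle
    simpa [hj] using Stream'.Seq.le_stable ρ (not_lt.mp hle) hN
  have hle : {i | i < j ∧ ∃ l', ρ.get? i = some (τ, l')}.ncard ≤ (Set.Iio j).ncard :=
    Set.ncard_le_ncard (fun _ hi => hi.1) (Set.finite_Iio j)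
  rw [hcard, Set.ncard_Iio_nat] at hle
  omega

theorem induces_iff_count {ρ : Stream'.Seq (Tid × Lab Acc Fen)} {lab : ℕ → Tid × Lab Acc Fen}
    (hρ : ∀ j, ρ.get? j = some (lab j)) {β : Behavior Acc Fen} :
    Induces ρ β ↔ ∀ τ k l, (β τ).get? k = some l ↔
      ∃ j, lab j = (τ, l) ∧ Nat.count (fun i => (lab i).1 = τ) j = k := by
  have hsched : ∀ τ i, (∃ l, lab i = (τ, l)) ↔ (lab i).1 = τ := fun τ i =>
    ⟨fun ⟨_, h⟩ => by rw [h], fun h => ⟨(lab i).2, by rw [← h]⟩⟩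
  simp only [Induces, hρ, Option.some.injEq, hsched, ncard_setOf_lt_and_eq_count]

theorem factorsThrough_count {α : Type*} {p : ℕ → Prop} [DecidablePred p] {f : ℕ → α}
    (hf : ∀ j, ¬ p j → f (j + 1) = f j) : Function.FactorsThrough f (Nat.count p) := by
  have hle : ∀ i j, i ≤ j → Nat.count p i = Nat.count p j → f i = f j := by
    intro i j hij
    induction j, hij using Nat.le_induction with
    | base => exact fun _ => rfl
    | succ j hij ih =>
      intro hc
      have hmono := Nat.count_monotone p hij
      rw [Nat.count_succ] at hc
      split_ifs at hc with hj
      · omega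
      · rw [hf j hj]
        exact ih hc
  intro i j hc
  rcases le_total i j with hij | hji
  · exact hle i j hij hc
  · exact (hle j i hji hc.symm).symm

theorem count_eq_of_forall_not {p : ℕ → Prop} [DecidablePred p] {k j₀ : ℕ}
    (hp : ∀ j, Nat.count p j = k → ¬ p j) (h₀ : Nat.count p j₀ = k) :
    ∀ j ≥ j₀, Nat.count p j = k := by
  intro j hj
  induction j, hj using Nat.le_induction with
  | base => exact h₀
  | succ j _ ih => rw [Nat.count_succ, if_neg (hp j ih), ih, add_zero]

/-- `s` is the sequence of states along the trace `σ` of `S`, and `σ` ends only in a state without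
outgoing steps. -/
structure LTS.IsMaximalTrace {A : Type} (S : LTS A) (σ : Stream'.Seq A) (s : ℕ → S.Q) : Prop where
  start : s 0 = S.init
  step : ∀ k l, σ.get? k = some l → S.step (s k) l (s (k + 1))
  halts : ∀ k, (∀ i < k, σ.get? i ≠ none) → σ.get? k = none → ∀ l q, ¬ S.step (s k) l q

variable {P : Program Acc Fen} {st : ℕ → P.lts.Q} {lab : ℕ → Tid × Lab Acc Fen}

variable (st lab) in
/-- The state of thread `τ` after its first `k` steps, in the run with states `st` and labels
`lab`; the initial state if the thread takes fewer steps. -/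
noncomputable def localState (τ : Tid) : ℕ → (P τ).Q :=
  Function.extend (Nat.count fun i => (lab i).1 = τ) (fun j => st j τ) fun _ => (P τ).init

theorem localState_count (hstep : ∀ j, P.lts.step (st j) (lab j) (st (j + 1))) (τ : Tid)
    (j : ℕ) : localState st lab τ (Nat.count (fun i => (lab i).1 = τ) j) = st j τ :=
  Function.FactorsThrough.extend_apply
    (factorsThrough_count fun j hj => (hstep j).2 τ (Ne.symm hj)) _ j

theorem Program.enabled_of_step {p : ∀ τ, (P τ).Q} {τ : Tid} {l : Lab Acc Fen} {q : (P τ).Q}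
    (h : (P τ).step (p τ) l q) : P.Enabled τ p := by
  classical
  have hq := Function.update_self τ q p
  exact ⟨l, Function.update p τ q, hq.symm ▸ h, fun π hπ => Function.update_of_ne hπ _ _⟩

theorem isMaximalTrace_localState {β : Behavior Acc Fen} (hst : st 0 = P.lts.init)
    (hstep : ∀ j, P.lts.step (st j) (lab j) (st (j + 1)))
    (hfair : ∀ τ k, (∀ j ≥ k, P.Enabled τ (st j)) → ∃ j ≥ k, (lab j).1 = τ)
    (hβ : ∀ τ k l, (β τ).get? k = some l ↔
      ∃ j, lab j = (τ, l) ∧ Nat.count (fun i => (lab i).1 = τ) j = k) (τ : Tid) :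
    (P τ).IsMaximalTrace (β τ) (localState st lab τ) := by
  have hloc := localState_count hstep τ
  have hsucc : ∀ k l, (β τ).get? k = some l →
      ∃ j, lab j = (τ, l) ∧ Nat.count (fun i => (lab i).1 = τ) j = k ∧
        Nat.count (fun i => (lab i).1 = τ) (j + 1) = k + 1 := by
    intro k l hl
    obtain ⟨j, hj, hk⟩ := (hβ τ k l).mp hl
    exact ⟨j, hj, hk, by rw [Nat.count_succ, if_pos (by rw [hj]), hk]⟩
  refine ⟨?_, fun k l hl => ?_, fun k hlt hk l q hq => ?_⟩
  · rw [← Nat.count_zero fun i => (lab i).1 = τ, hloc 0, hst]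
    rfl
  · obtain ⟨j, hj, hk, hk'⟩ := hsucc k l hl
    rw [← hk', ← hk, hloc, hloc]
    have hj' := (hstep j).1
    rwa [hj] at hj'
  · have hnot : ∀ j, Nat.count (fun i => (lab i).1 = τ) j = k → (lab j).1 ≠ τ := by
      intro j hj hτ
      have hget := (hβ τ k (lab j).2).mpr ⟨j, by rw [← hτ], hj⟩
      rw [hk] at hget
      cases hget
    obtain ⟨j₀, hj₀⟩ : ∃ j, Nat.count (fun i => (lab i).1 = τ) j = k := by
      cases k with
      | zero => exact ⟨0, Nat.count_zero _⟩
      | succ k =>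
        obtain ⟨l', hl'⟩ := Option.ne_none_iff_exists'.mp (hlt k k.lt_succ_self)
        obtain ⟨j, -, -, hj⟩ := hsucc k l' hl'
        exact ⟨j + 1, hj⟩
    have hconst := count_eq_of_forall_not hnot hj₀
    obtain ⟨j, hj, hτ⟩ := hfair τ j₀ fun j hj => Program.enabled_of_step (l := l) (q := q)
      (by rwa [← hloc j, hconst j hj])
    exact hnot j (hconst j hj) hτ

theorem finite_or_exists_isMaximalTrace {β : Behavior Acc Fen} (h : β ∈ P.behTF) :
    β.Finite ∨ ∀ τ, ∃ s, (P τ).IsMaximalTrace (β τ) s := by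
  obtain ⟨μ, hrun, hfair, hind⟩ := h
  by_cases hμ : μ.Terminates
  · exact .inl (hind.finite (Stream'.Seq.terminates_map_iff.mpr hμ))
  obtain ⟨st, lab, hst, hget⟩ := hrun.exists_states hμ
  refine .inr fun τ => ⟨_, isMaximalTrace_localState hst (fun j => hrun.trans j _ (hget j))
    (fun τ k hen => ?_) ((induces_iff_count fun j => ?_).mp hind) τ⟩
  · obtain ⟨j, hj, t, ht, hτ⟩ := hfair.resolve_left hμ τ k fun j hj t ht => by
      rw [hget j] at ht
      exact Option.some.inj ht ▸ hen j hj
    rw [hget j] at ht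
    exact ⟨j, hj, Option.some.inj ht ▸ hτ⟩
  · rw [Stream'.Seq.map_get?, hget j]
    rfl

end Runs

/-! ### Traces of a fenced client thread -/

/-- The program point of the next memory access: the fences before it are skipped. -/
def PC.skip : PC → PC
  | .lockFenceRel => .swap
  | .lockFenceAcq => .readNext
  | .unlockFenceRel => .readNext
  | .unlockFenceAcq succ => if succ = 0 then .cas else .handOver succ
  | q => q

/-- A rank that every step except an idle iteration of a loop decreases. -/
def PC.rank : PC → ℕ
  | .setLocked => 13
  | .clearNext => 12
  | .lockFenceRel => 11
  | .swap => 10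
  | .link _ => 9
  | .spin => 8
  | .lockFenceAcq => 7
  | .unlockFenceRel => 6
  | .readNext => 5
  | .unlockFenceAcq _ => 4
  | .cas => 3
  | .awaitNext => 2
  | .handOver _ => 1
  | .done => 0

/-- The program points of the two loops. -/
def PC.IsLoop : PC → Prop
  | .spin | .awaitNext => True
  | _ => False

/-- The memory accesses of a fenced thread with node `n`, with arbitrary access annotations. -/
inductive MemStep {Acc Fen : Type} (n : Val) : PC → Lab Acc Fen → PC → Prop
  | setLocked (o) : MemStep n .setLocked (.W o (.locked n) 1) .clearNext
  | clearNext (o) : MemStep n .clearNext (.W o (.next n) 0) .lockFenceRel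
  | swap (o) (pred : Val) : MemStep n .swap (.U o .lock pred n)
      (if pred = 0 then .unlockFenceRel else .link pred)
  | link (o) (pred : Val) : MemStep n (.link pred) (.W o (.next pred) n) .spin
  | spin (o) (v : Val) : MemStep n .spin (.R o (.locked n) v)
      (if v = 1 then .spin else .lockFenceAcq)
  | readNext (o) (succ : Val) :
      MemStep n .readNext (.R o (.next n) succ) (.unlockFenceAcq succ)
  | casSuccess (o) : MemStep n .cas (.U o .lock n 0) .done
  | casFail (o) (v : Val) (hv : v ≠ n) : MemStep n .cas (.R o .lock v) .awaitNext
  | awaitNext (o) (succ : Val) : MemStep n .awaitNext (.R o (.next n) succ)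
      (if succ = 0 then .awaitNext else .handOver succ)
  | handOver (o) (succ : Val) : MemStep n (.handOver succ) (.W o (.locked succ) 0) .done

/-- The accesses that leave a thread with node `n` where it is. -/
inductive IsIdle {Acc Fen : Type} (n : Val) : PC → Lab Acc Fen → Prop
  | spin (o) : IsIdle n .spin (.R o (.locked n) 1)
  | awaitNext (o) : IsIdle n .awaitNext (.R o (.next n) 0)

/-- The steps of a fenced thread with node `n` in any of the models: an access, possibly after
silent fences, or a fence, which is a label without location or an access of `fenceLoc`. -/
inductive ClientStep {Acc Fen : Type} (n : Val) (q : PC) (l : Lab Acc Fen) (q' : PC) : Prop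
  | access (h : MemStep n q.skip l q')
  | fence (hl : l.loc = none ∨ l.loc = some .fenceLoc) (hskip : q'.skip = q.skip)
      (hrank : q'.rank < q.rank)

section ThreadTraces

variable {Acc Fen : Type} {n : Val}

theorem PC.rank_skip_le (q : PC) : q.skip.rank ≤ q.rank := by
  cases q with
  | unlockFenceAcq succ =>
    simp only [PC.skip]
    split_ifs <;> simp [PC.rank]
  | _ => simp [PC.skip, PC.rank]

theorem PC.skip_eq_of_isLoop {q : PC} (h : q.skip.IsLoop) : q.skip = q := by
  cases q with
  | unlockFenceAcq succ =>
    simp only [PC.skip] at h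
    split_ifs at h <;> exact h.elim
  | _ => first | rfl | exact h.elim

theorem IsIdle.isLoop {q : PC} {l : Lab Acc Fen} (h : IsIdle n q l) : q.IsLoop := by
  cases h <;> trivial

theorem MemStep.rank_lt_or_isIdle {q q' : PC} {l : Lab Acc Fen} (h : MemStep n q l q') :
    q'.rank < q.rank ∨ q' = q ∧ IsIdle n q l := by
  cases h with
  | spin o v =>
    by_cases hv : v = 1
    · subst hv
      exact .inr ⟨if_pos rfl, .spin o⟩
    · simp [hv, PC.rank]
  | awaitNext o v =>
    by_cases hv : v = 0
    · subst hv
      exact .inr ⟨if_pos rfl, .awaitNext o⟩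
    · simp [hv, PC.rank]
  | swap o pred => split_ifs <;> simp [PC.rank]
  | _ => simp [PC.rank]

theorem MemStep.rank_le {q q' : PC} {l : Lab Acc Fen} (h : MemStep n q l q') :
    q'.rank ≤ q.rank := by
  rcases h.rank_lt_or_isIdle with h | ⟨rfl, -⟩
  exacts [h.le, le_rfl]

theorem ClientStep.rank_le {q q' : PC} {l : Lab Acc Fen} (h : ClientStep n q l q') :
    q'.rank ≤ q.rank := by
  cases h with
  | access h => exact h.rank_le.trans q.rank_skip_le
  | fence _ _ hrank => exact hrank.le

theorem ClientStep.isIdle_of_rank_le {q q' : PC} {l : Lab Acc Fen} (h : ClientStep n q l q')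
    (hrank : q.rank ≤ q'.rank) : q.skip = q ∧ q' = q ∧ IsIdle n q l ∧ MemStep n q l q' := by
  cases h with
  | access h =>
    rcases h.rank_lt_or_isIdle with hlt | ⟨hq', hidle⟩
    · exact absurd (hlt.trans_le q.rank_skip_le) hrank.not_gt
    · have hskip := PC.skip_eq_of_isLoop hidle.isLoop
      rw [hskip] at hq' hidle h
      exact ⟨hskip, hq', hidle, h⟩
  | fence _ _ hlt => exact absurd hlt hrank.not_gt

/-- The program points that a fenced thread with node `n` passes along its trace `σ`, which ends
only at the end of the program. -/
structure ThreadTrace (n : Val) (σ : Stream'.Seq (Lab Acc Fen)) where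
  pc : ℕ → PC
  start : pc 0 = .setLocked
  step : ∀ k l, σ.get? k = some l → ClientStep n (pc k) l (pc (k + 1))
  halts : ∀ k, (∀ i < k, σ.get? i ≠ none) → σ.get? k = none → pc k = .done

namespace ThreadTrace

variable {σ : Stream'.Seq (Lab Acc Fen)} (T : ThreadTrace n σ)

/-- The `k`-th step of the thread accesses memory at the program point `q` with label `l`. -/
structure At (q : PC) (k : ℕ) (l : Lab Acc Fen) : Prop where
  get : σ.get? k = some l
  skip_eq : (T.pc k).skip = q
  step : MemStep n q l (T.pc (k + 1))

variable {T}

theorem exists_at {k : ℕ} {l : Lab Acc Fen} (h : σ.get? k = some l) {x : Loc}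
    (hl : l.loc = some x) (hx : x ≠ .fenceLoc) : ∃ q, T.At q k l := by
  cases T.step k l h with
  | access hs => exact ⟨_, h, rfl, hs⟩
  | fence hf => simp [hl, hx] at hf

theorem get_ne_none_of_lt {i k : ℕ} {l : Lab Acc Fen} (h : σ.get? k = some l) (hik : i < k) :
    σ.get? i ≠ none := by
  obtain ⟨l', hl'⟩ := Stream'.Seq.ge_stable σ hik.le h
  simp [hl']

theorem rank_anti {j k : ℕ} (hjk : j ≤ k) (h : ∀ i < k, σ.get? i ≠ none) :
    (T.pc k).rank ≤ (T.pc j).rank := by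
  induction k, hjk using Nat.le_induction with
  | base => exact le_rfl
  | succ k _ ih =>
    obtain ⟨l, hl⟩ := Option.ne_none_iff_exists'.mp (h k k.lt_succ_self)
    exact (T.step k l hl).rank_le.trans (ih fun i hi => h i (Nat.lt_succ_of_lt hi))

namespace At

variable {q q' : PC} {j k : ℕ} {l l' : Lab Acc Fen}

theorem rank_le_of_lt (hk : T.At q' k l') (h : j < k) :
    q'.rank ≤ (T.pc (j + 1)).rank := by
  rw [← hk.skip_eq]
  exact (PC.rank_skip_le _).trans
    (T.rank_anti (Nat.succ_le_of_lt h) fun i hi => get_ne_none_of_lt hk.get hi)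

theorem lt_of_rank_lt (hj : T.At q j l) (hk : T.At q' k l') (h : q'.rank < q.rank) : j < k := by
  rcases lt_trichotomy j k with hlt | rfl | hlt
  · exact hlt
  · exact absurd (hj.skip_eq.symm.trans hk.skip_eq) fun heq => h.ne' (congrArg PC.rank heq)
  · exact absurd ((hj.rank_le_of_lt hlt).trans hk.step.rank_le) h.not_ge

theorem le_of_not_isLoop (hj : T.At q j l) (hk : T.At q k l') (hq : ¬ q.IsLoop) : k ≤ j := by
  by_contra hlt
  rcases hj.step.rank_lt_or_isIdle with hr | ⟨-, hidle⟩
  · exact hr.not_ge (hk.rank_le_of_lt (not_le.mp hlt))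
  · exact hq hidle.isLoop

theorem unique (hj : T.At q j l) (hk : T.At q k l') (hq : ¬ q.IsLoop) : j = k ∧ l = l' := by
  obtain rfl := le_antisymm (hk.le_of_not_isLoop hj hq) (hj.le_of_not_isLoop hk hq)
  exact ⟨rfl, Option.some.inj (hj.get.symm.trans hk.get)⟩

end At

variable (T)

/-- The thread passes the program point `q` with label `l`, up to the access annotation. -/
def Passes (q : PC) (l : Acc → Lab Acc Fen) : Prop := ∃ k o, T.At q k (l o)

/-- The thread has initialized its node, and its swap has returned `pred`. -/
def Swapped (pred : Val) : Prop :=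
  T.Passes .setLocked (.W · (.locked n) 1) ∧ T.Passes .clearNext (.W · (.next n) 0) ∧
    T.Passes .swap (.U · .lock pred n)

/-- The thread has entered the queue behind `pred`; there is nothing to link if `pred` is null. -/
def Enqueued (pred : Val) : Prop :=
  T.Swapped pred ∧ (pred = 0 ∨ T.Passes (.link pred) (.W · (.next pred) n))

/-- The thread has read its successor `succ`, either at once or after a failed CAS. -/
def ReadsSucc (succ : Val) : Prop :=
  T.Passes .readNext (.R · (.next n) succ) ∨
    (∃ v ≠ n, T.Passes .cas (.R · .lock v)) ∧ T.Passes .awaitNext (.R · (.next n) succ)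

/-- What a thread has done when it is at a program point. -/
def Past : PC → Prop
  | .clearNext => T.Passes .setLocked (.W · (.locked n) 1)
  | .swap => T.Passes .setLocked (.W · (.locked n) 1) ∧ T.Passes .clearNext (.W · (.next n) 0)
  | .link pred => pred ≠ 0 ∧ T.Swapped pred
  | .spin => ∃ pred ≠ 0, T.Enqueued pred
  | .readNext | .cas => ∃ pred, T.Enqueued pred
  | .awaitNext => (∃ pred, T.Enqueued pred) ∧ ∃ v ≠ n, T.Passes .cas (.R · .lock v)
  | .handOver succ => (∃ pred, T.Enqueued pred) ∧ succ ≠ 0 ∧ T.ReadsSucc succ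
  | .done => (∃ pred, T.Enqueued pred) ∧ (T.Passes .cas (.U · .lock n 0) ∨
      ∃ succ ≠ 0, T.ReadsSucc succ ∧ T.Passes (.handOver succ) (.W · (.locked succ) 0))
  | _ => True

/-- The thread eventually makes nothing but idle steps at `q`, with label `l`. -/
def StuckAt (q : PC) (l : Acc → Lab Acc Fen) : Prop := ∃ k₀, ∀ k ≥ k₀, ∃ o, T.At q k (l o)

variable {T}

theorem At.past_succ {q : PC} {k : ℕ} {l : Lab Acc Fen} (h : T.At q k l) (hp : T.Past q) :
    T.Past (T.pc (k + 1)).skip := by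
  have hs := h.step
  revert h
  generalize T.pc (k + 1) = q' at hs
  intro h
  cases hs with
  | setLocked o => exact ⟨k, o, h⟩
  | clearNext o => exact ⟨hp, k, o, h⟩
  | swap o pred =>
    have hswapped : T.Swapped pred := ⟨hp.1, hp.2, k, o, h⟩
    split_ifs with hpred
    · exact ⟨pred, hswapped, .inl hpred⟩
    · exact ⟨hpred, hswapped⟩
  | link o pred => exact ⟨pred, hp.1, hp.2, .inr ⟨k, o, h⟩⟩
  | spin o v =>
    obtain ⟨pred, hpred, henq⟩ := hp
    split_ifs
    · exact ⟨pred, hpred, henq⟩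
    · exact ⟨pred, henq⟩
  | readNext o succ =>
    simp only [PC.skip]
    split_ifs with hsucc
    · exact hp
    · exact ⟨hp, hsucc, .inl ⟨k, o, h⟩⟩
  | casSuccess o => exact ⟨hp, .inl ⟨k, o, h⟩⟩
  | casFail o v hv => exact ⟨hp, v, hv, k, o, h⟩
  | awaitNext o succ =>
    split_ifs with hsucc
    · exact hp
    · exact ⟨hp.1, hsucc, .inr ⟨hp.2, k, o, h⟩⟩
  | handOver o succ => exact ⟨hp.1, .inr ⟨succ, hp.2.1, hp.2.2, k, o, h⟩⟩

variable (T)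

theorem past (k : ℕ) (h : ∀ i < k, σ.get? i ≠ none) : T.Past (T.pc k).skip := by
  induction k with
  | zero =>
    rw [T.start]
    trivial
  | succ k ih =>
    obtain ⟨l, hl⟩ := Option.ne_none_iff_exists'.mp (h k k.lt_succ_self)
    have hp := ih fun i hi => h i (Nat.lt_succ_of_lt hi)
    cases T.step k l hl with
    | access hs => exact At.past_succ ⟨hl, rfl, hs⟩ hp
    | fence _ hskip => rwa [hskip]

variable {T} in
theorem At.past {q : PC} {k : ℕ} {l : Lab Acc Fen} (h : T.At q k l) : T.Past q :=
  h.skip_eq ▸ T.past k fun _ hi => get_ne_none_of_lt h.get hi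

theorem past_done (h : σ.Terminates) : T.Past .done := by
  classical
  have hlt : ∀ i < Nat.find h, σ.get? i ≠ none := fun i hi => Nat.find_min h hi
  have hp := T.past _ hlt
  rwa [T.halts _ hlt (Nat.find_spec h)] at hp

theorem eventually_isIdle (h : ¬ σ.Terminates) :
    ∃ k₀, ∀ k ≥ k₀, ∃ l, T.At (T.pc k₀) k l ∧ IsIdle n (T.pc k₀) l := by
  let k₀ := Function.argmin fun k => (T.pc k).rank
  have hmin : ∀ k, (T.pc k₀).rank ≤ (T.pc k).rank := fun k =>
    Function.argmin_le (fun k => (T.pc k).rank) k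
  have hget : ∀ k, σ.get? k ≠ none := fun k hk => h ⟨k, hk⟩
  have hidle : ∀ k ≥ k₀, T.pc (k + 1) = T.pc k ∧
      ∃ l, T.At (T.pc k) k l ∧ IsIdle n (T.pc k) l := by
    intro k hk
    obtain ⟨l, hl⟩ := Option.ne_none_iff_exists'.mp (hget k)
    obtain ⟨hskip, hpc, hi, hs⟩ := (T.step k l hl).isIdle_of_rank_le
      ((rank_anti hk fun i _ => hget i).trans (hmin (k + 1)))
    exact ⟨hpc, l, ⟨hl, hskip, hs⟩, hi⟩
  have hconst : ∀ k ≥ k₀, T.pc k = T.pc k₀ := by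
    intro k hk
    induction k, hk using Nat.le_induction with
    | base => rfl
    | succ k hk ih => exact (hidle k hk).1.trans ih
  exact ⟨k₀, fun k hk => hconst k hk ▸ (hidle k hk).2⟩

theorem outcome : (σ.Terminates ∧ T.Past .done) ∨
    (T.Past .spin ∧ T.StuckAt .spin (.R · (.locked n) 1)) ∨
    (T.Past .awaitNext ∧ T.StuckAt .awaitNext (.R · (.next n) 0)) := by
  by_cases h : σ.Terminates
  · exact .inl ⟨h, T.past_done h⟩
  obtain ⟨k₀, hk₀⟩ := T.eventually_isIdle h
  have hp : T.Past (T.pc k₀) := by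
    obtain ⟨l, hat, -⟩ := hk₀ k₀ le_rfl
    exact hat.skip_eq ▸ T.past k₀ fun i _ hi => h ⟨i, hi⟩
  obtain ⟨_, -, hi⟩ := hk₀ k₀ le_rfl
  generalize T.pc k₀ = q at *
  right
  cases hi with
  | spin _ =>
    refine .inl ⟨hp, k₀, fun k hk => ?_⟩
    obtain ⟨_, hat, hi⟩ := hk₀ k hk
    cases hi with | spin o => exact ⟨o, hat⟩
  | awaitNext _ =>
    refine .inr ⟨hp, k₀, fun k hk => ?_⟩
    obtain ⟨_, hat, hi⟩ := hk₀ k hk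
    cases hi with | awaitNext o => exact ⟨o, hat⟩

end ThreadTrace

end ThreadTraces

/-! ### From the client programs to thread traces -/

section Simulation

variable {n : Val} {q q' : PC}

theorem Step.memStep {c : CLab} {l : ELab} (h : Step true n q c q') (hc : c.forget = some l) :
    MemStep n q.skip c q' := by
  cases h <;> first | (constructor; done) | (constructor; assumption) | cases hc

theorem MemStep.forget {c : CLab} {l : ELab} (h : MemStep n q c q') (hc : c.forget = some l) :
    MemStep n q l q' := by
  cases h <;> cases hc <;> constructor
  assumption

theorem Step.skip_eq_of_fence {o : Mode} (h : Step true n q (.F o) q') : q'.skip = q.skip := by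
  cases h
  case unlockFenceAcq succ =>
    simp only [PC.skip]
    split_ifs <;> rfl
  all_goals rfl

theorem Step.rank_lt_of_fence {o : Mode} (h : Step true n q (.F o) q') : q'.rank < q.rank := by
  cases h
  case unlockFenceAcq succ => split_ifs <;> simp [PC.rank]
  all_goals simp [PC.rank]

theorem skip_eq_of_fences (h : ReflTransGen (fun p p' => ∃ o, Step true n p (.F o) p') q q') :
    q'.skip = q.skip := by
  induction h with
  | refl => rfl
  | tail _ h ih => exact h.choose_spec.skip_eq_of_fence.trans ih

theorem PC.fences_skip (n : Val) :
    ∀ q : PC, ReflTransGen (fun p p' => ∃ o, Step true n p (.F o) p') q q.skip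
  | .lockFenceRel => .single ⟨_, .lockFenceRel⟩
  | .lockFenceAcq => .head ⟨_, .lockFenceAcq⟩ (.single ⟨_, .unlockFenceRel⟩)
  | .unlockFenceRel => .single ⟨_, .unlockFenceRel⟩
  | .unlockFenceAcq succ => .single ⟨_, .unlockFenceAcq succ⟩
  | .setLocked | .clearNext | .swap | .link _ | .spin | .readNext | .cas | .awaitNext
  | .handOver _ | .done => .refl

theorem PC.exists_access (n : Val) :
    ∀ {q : PC}, q ≠ .done → ∃ c q' l, Step true n q.skip c q' ∧ CLab.forget c = some l
  | .setLocked, _ => ⟨_, _, _, .setLocked, rfl⟩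
  | .clearNext, _ => ⟨_, _, _, .clearNext, rfl⟩
  | .lockFenceRel, _ | .swap, _ => ⟨_, _, _, .swap 0, rfl⟩
  | .link pred, _ => ⟨_, _, _, .link pred, rfl⟩
  | .spin, _ => ⟨_, _, _, .spin 0, rfl⟩
  | .lockFenceAcq, _ | .unlockFenceRel, _ | .readNext, _ => ⟨_, _, _, .readNext 0, rfl⟩
  | .unlockFenceAcq 0, _ | .cas, _ => ⟨_, _, _, .casSuccess, rfl⟩
  | .awaitNext, _ => ⟨_, _, _, .awaitNext 0, rfl⟩
  | .unlockFenceAcq (succ + 1), _ => ⟨_, _, _, .handOver (succ + 1), rfl⟩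
  | .handOver succ, _ => ⟨_, _, _, .handOver succ, rfl⟩
  | .done, h => absurd rfl h

theorem PC.exists_access_or_fence (n : Val) (h : q ≠ .done) :
    (∃ c q' l, Step true n q c q' ∧ CLab.forget c = some l) ∨
      ∃ o q', Step true n q (.F o) q' := by
  rcases (PC.fences_skip n q).cases_head with hskip | ⟨q', ⟨o, hs⟩, -⟩
  · rw [hskip]
    exact .inl (PC.exists_access n h)
  · exact .inr ⟨o, q', hs⟩

theorem Step.clientStep {c : CLab} (h : Step true n q c q') : ClientStep n q c q' := by
  cases hc : c.forget with
  | some l => exact .access (h.memStep hc)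
  | none =>
    cases c with
    | F o => exact .fence (.inl rfl) h.skip_eq_of_fence h.rank_lt_of_fence
    | _ => cases hc

/-- A maximal trace of a transition system that takes only client steps, and takes one at every
program point but the last. -/
def ThreadTrace.ofMaximalTrace {Acc Fen : Type} {R : PC → Lab Acc Fen → PC → Prop}
    {σ : Stream'.Seq (Lab Acc Fen)} {s : ℕ → PC}
    (h : LTS.IsMaximalTrace ⟨PC, .setLocked, R⟩ σ s)
    (hstep : ∀ q l q', R q l q' → ClientStep n q l q')
    (hex : ∀ q, q ≠ .done → ∃ l q', R q l q') : ThreadTrace n σ where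
  pc := s
  start := h.start
  step k l hl := hstep _ _ _ (h.step k l hl)
  halts k hlt hk := by
    by_contra hne
    obtain ⟨l, q, hs⟩ := hex _ hne
    exact h.halts k hlt hk l q hs

/-- The node of a thread of the client. -/
def node (a b : Val) (τ : Tid) : Val := if τ = 0 then a else b

theorem finite_or_threadTrace_of_plain (i : FenceReading) {a b : Val} {β : Behavior Unit Empty}
    (h : β ∈ ((mcsClient true a b).plain i).behTF) :
    β.Finite ∨ ∀ τ, Nonempty (ThreadTrace (node a b τ) (β τ)) := by
  refine (finite_or_exists_isMaximalTrace h).imp_right fun h τ => ?_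
  obtain ⟨s, hs⟩ := h τ
  cases i with
  | rmw =>
    refine ⟨.ofMaximalTrace hs ?_ fun q hq => ?_⟩
    · rintro q l q' (⟨c, h, hc⟩ | ⟨o, v, h, rfl⟩)
      · exact .access ((h.memStep hc).forget hc)
      · exact .fence (.inr rfl) h.skip_eq_of_fence h.rank_lt_of_fence
    · rcases PC.exists_access_or_fence _ hq with ⟨c, q', l, h, hc⟩ | ⟨o, q', h⟩
      · exact ⟨l, q', .inl ⟨c, h, hc⟩⟩
      · exact ⟨_, q', .inr ⟨o, 0, h, rfl⟩⟩
  | nop =>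
    refine ⟨.ofMaximalTrace hs ?_ fun q hq => ?_⟩
    · rintro q l q' ⟨q₁, c, hfences, h, hc⟩
      exact .access (skip_eq_of_fences hfences ▸ (h.memStep hc).forget hc)
    · obtain ⟨c, q', l, h, hc⟩ := PC.exists_access _ hq
      exact ⟨l, q', _, c, PC.fences_skip _ q, h, hc⟩

/-- The program counter follows the annotated program step by step, so it also determines the
positions of the fences. -/
def ThreadTrace.IsExact {σ : Stream'.Seq CLab} (T : ThreadTrace n σ) : Prop :=
  ∀ k l, σ.get? k = some l → Step true n (T.pc k) l (T.pc (k + 1))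

theorem finite_or_threadTrace {a b : Val} {β : Behavior Mode Mode}
    (h : β ∈ (mcsClient true a b).behTF) :
    β.Finite ∨ ∀ τ, ∃ T : ThreadTrace (node a b τ) (β τ), T.IsExact := by
  refine (finite_or_exists_isMaximalTrace h).imp_right fun h τ => ?_
  obtain ⟨s, hs⟩ := h τ
  refine ⟨.ofMaximalTrace hs (fun _ _ _ h => Step.clientStep h) fun q hq => ?_, hs.step⟩
  rcases PC.exists_access_or_fence _ hq with ⟨c, q', l, h, -⟩ | ⟨o, q', h⟩
  exacts [⟨c, q', h⟩, ⟨_, q', h⟩]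

end Simulation

/-! ### Coherence and fairness -/

section Coherence

variable {Acc Fen : Type} {G : ExecGraph Acc Fen} {β : Behavior Acc Fen}
  {hb : Event Acc Fen → Event Acc Fen → Prop}

theorem Event.isW_of_valw {e : Event Acc Fen} {v : Val} (h : e.valw = some v) : e.IsW := by
  rcases e with _ | ⟨_, _, _ | _ | _ | _⟩ <;> trivial

theorem Event.isR_of_valr {e : Event Acc Fen} {v : Val} (h : e.valr = some v) : e.IsR := by
  rcases e with _ | ⟨_, _, _ | _ | _ | _⟩ <;> trivial

theorem Behavior.act_mem_events {k : ℕ} {τ : Tid} {l : Lab Acc Fen} :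
    .act k τ l ∈ β.events ↔ (β τ).get? k = some l := by
  constructor
  · rintro (⟨_, h⟩ | ⟨_, _, _, h, he⟩)
    · cases h
    · cases he
      exact h
  · exact fun h => .inr ⟨k, τ, l, h, rfl⟩

namespace ExecGraph

/-- `w` is an event of `G` that writes `v` to `x`. -/
structure Writes (G : ExecGraph Acc Fen) (w : Event Acc Fen) (x : Loc) (v : Val) : Prop where
  mem : w ∈ G.E
  loc : w.loc = some x
  valw : w.valw = some v

variable {x : Loc} {v v' : Val} {w w' r u : Event Acc Fen}

theorem writes_init (G : ExecGraph Acc Fen) (x : Loc) : G.Writes (.init x) x 0 :=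
  ⟨G.init_mem x, rfl, rfl⟩

theorem Writes.mo_or_mo (h : G.Writes w x v) (h' : G.Writes w' x v') (hne : w ≠ w') :
    G.mo w w' ∨ G.mo w' w :=
  G.mo_total w h.mem w' h'.mem (Event.isW_of_valw h.valw) (Event.isW_of_valw h'.valw)
    (h.loc.trans h'.loc.symm) hne

theorem exists_rf_writes (hr : r ∈ G.E) (hx : r.loc = some x) (hv : r.valr = some v) :
    ∃ w, G.rf w r ∧ G.Writes w x v := by
  obtain ⟨w, hw⟩ := G.rf_total r hr (Event.isR_of_valr hv)
  obtain ⟨hmem, -, -, -, hloc, hval⟩ := G.rf_dom _ _ hw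
  exact ⟨w, hw, hmem, hloc.trans hx, hval.trans hv⟩

theorem Fair.not_eventually_fr (hG : G.Fair) (hw : w ∈ G.E) (τ : Tid) (k₀ : ℕ) :
    ¬ ∀ k ≥ k₀, ∃ l, G.fr (.act k τ l) w := by
  intro h
  have : Nonempty (Lab Acc Fen) := ⟨(h k₀ le_rfl).choose⟩
  choose! l hl using h
  have hinj : Set.InjOn (fun k => Event.act k τ (l k)) (Set.Ici k₀) := fun j _ k _ hjk => by
    injection hjk
  exact ((Set.Ici_infinite k₀).image hinj) <| (hG.2 w hw).subset <| by
    rintro _ ⟨k, hk, rfl⟩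
    exact hl k hk

/-- Coherence and atomicity with respect to a happens-before relation `hb`, in a form that all the
memory models provide. -/
structure Coherent (G : ExecGraph Acc Fen) (hb : Event Acc Fen → Event Acc Fen → Prop) : Prop where
  hb_of_po : ∀ {e e'}, G.po e e' → hb e e'
  hb_trans : ∀ {e₁ e₂ e₃}, hb e₁ e₂ → hb e₂ e₃ → hb e₁ e₃
  not_mo_of_hb : ∀ {e e'}, hb e e' → ¬ G.mo e' e
  not_fr_of_po : ∀ {e e'}, G.po e e' → ¬ G.fr e' e
  eco_irrefl : Irrefl (TransGen fun e e' => G.rf e e' ∨ G.mo e e' ∨ G.fr e e')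

namespace Coherent

theorem mo_of_hb (hG : G.Coherent hb) (h : G.Writes w x v) (h' : G.Writes w' x v') (hne : v ≠ v')
    (hhb : hb w w') : G.mo w w' := by
  refine (h.mo_or_mo h' ?_).resolve_right (hG.not_mo_of_hb hhb)
  rintro rfl
  exact hne (Option.some.inj (h.valw.symm.trans h'.valw))

theorem rf_asymm (hG : G.Coherent hb) (h : G.rf w r) : ¬ G.rf r w := fun h' =>
  hG.eco_irrefl w (.tail (.single (.inl h)) (.inl h'))

theorem mo_of_rf (hG : G.Coherent hb) (h : G.rf w u) (hu : u.IsW) : G.mo w u := by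
  obtain ⟨hw, hu', hw', -, hloc, -⟩ := G.rf_dom _ _ h
  refine (G.mo_total w hw u hu' hw' hu hloc ?_).resolve_right fun hmo =>
    hG.eco_irrefl w (.tail (.single (.inl h)) (.inr (.inl hmo)))
  rintro rfl
  exact hG.rf_asymm h h

theorem not_mo_of_rf_of_mo (hG : G.Coherent hb) (h : G.rf w u) (hw : G.mo w w') : ¬ G.mo w' u := by
  intro hmo
  have hne : u ≠ w' := by
    rintro rfl
    exact G.mo_irrefl _ hmo
  exact hG.eco_irrefl u (.tail (.single (.inr (.inr ⟨⟨w, h, hw⟩, hne⟩))) (.inr (.inl hmo)))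

theorem rmw_unique (hG : G.Coherent hb) (h : G.rf w u) (h' : G.rf w r) (hu : u.IsW) (hr : r.IsW) :
    u = r := by
  by_contra hne
  obtain ⟨-, hu', -, -, hloc, -⟩ := G.rf_dom _ _ h
  obtain ⟨-, hr', -, -, hloc', -⟩ := G.rf_dom _ _ h'
  rcases G.mo_total u hu' r hr' hu hr (hloc.symm.trans hloc') hne with hmo | hmo
  · exact hG.not_mo_of_rf_of_mo h' (hG.mo_of_rf h hu) hmo
  · exact hG.not_mo_of_rf_of_mo h (hG.mo_of_rf h' hr) hmo

end Coherent

end ExecGraph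

end Coherence

/-! ### Fair execution graphs of the fenced client -/

theorem Tid.eq_of_ne {τ σ ρ : Tid} (h : σ ≠ τ) (h' : ρ ≠ τ) : σ = ρ := by
  revert τ σ ρ
  decide

/-- A fair execution graph `G` with behavior `β` of the fenced client; `n τ` is the node of `τ`. -/
structure ClientGraph {Acc Fen : Type} (G : ExecGraph Acc Fen) (β : Behavior Acc Fen)
    (n : Tid → Val) where
  trace : ∀ τ, ThreadTrace (n τ) (β τ)
  events : β.events = G.E
  fair : G.Fair
  node_ne : ∀ τ, n τ ≠ 0
  node_inj : Function.Injective n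

namespace ClientGraph

variable {Acc Fen : Type} {G : ExecGraph Acc Fen} {β : Behavior Acc Fen} {n : Tid → Val}

/-- The `k`-th step of thread `τ` accesses memory at the program point `q` with label `l`. -/
abbrev At (C : ClientGraph G β n) (τ : Tid) (q : PC) (k : ℕ) (l : Lab Acc Fen) : Prop :=
  (C.trace τ).At q k l

/-- The `k`-th step of thread `τ` is a read-modify-write of the lock with label `l`: its swap or its
successful CAS. -/
def LockRMW (C : ClientGraph G β n) (τ : Tid) (k : ℕ) (l : Lab Acc Fen) : Prop :=
  (∃ o pred, l = .U o .lock pred (n τ) ∧ C.At τ .swap k l) ∨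
    ∃ o, l = .U o .lock (n τ) 0 ∧ C.At τ .cas k l

/-- The two kinds of synchronization between the threads of the client: a read-modify-write of the
lock releases, every access to the lock acquires, and the thread that links its node to the queue
behind another one has initialized it before that one hands over the lock. -/
structure Synchronizes (C : ClientGraph G β n) (hb : Event Acc Fen → Event Acc Fen → Prop) :
    Prop extends G.Coherent hb where
  hb_of_lock : ∀ {w r}, G.rf w r → w.IsU → w.loc = some .lock → hb w r
  hb_of_link : ∀ {τ τ' i j k m q succ l lw lr l'}, C.At τ .setLocked i l → C.At τ (.link q) j lw →
    G.rf (.act j τ lw) (.act k τ' lr) → C.At τ' .readNext k lr → C.At τ' (.handOver succ) m l' →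
    hb (.act i τ l) (.act m τ' l')

variable {C : ClientGraph G β n} {hb : Event Acc Fen → Event Acc Fen → Prop}

section Accesses

variable {τ τ' : Tid} {j k : ℕ} {q q' : PC} {l l' : Lab Acc Fen} {x : Loc} {v : Val}
  {w : Event Acc Fen}

theorem mem_iff (C : ClientGraph G β n) : .act k τ l ∈ G.E ↔ (β τ).get? k = some l :=
  C.events ▸ Behavior.act_mem_events

theorem mem (h : C.At τ q k l) : .act k τ l ∈ G.E := C.mem_iff.mpr h.get

theorem writes (h : C.At τ q k l) (hx : l.loc = some x) (hv : l.valw = some v) :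
    G.Writes (.act k τ l) x v := ⟨mem h, hx, hv⟩

theorem po_of_rank_lt (h : C.At τ q j l) (h' : C.At τ q' k l') (hr : q'.rank < q.rank) :
    G.po (.act j τ l) (.act k τ l') := ⟨mem h, mem h', rfl, h.lt_of_rank_lt h' hr⟩

theorem po_init (h : C.At τ q k l) (x : Loc) : G.po (.init x) (.act k τ l) :=
  ⟨G.init_mem x, mem h, trivial⟩

theorem exists_at_of_writes (C : ClientGraph G β n) (h : G.Writes (.act k τ l) x v)
    (hx : x ≠ .fenceLoc) : ∃ q, C.At τ q k l :=
  ThreadTrace.exists_at (C.mem_iff.mp h.mem) h.loc hx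

theorem LockRMW.isU (h : C.LockRMW τ k l) : (Event.act k τ l).IsU := by
  rcases h with ⟨o, pred, rfl, -⟩ | ⟨o, rfl, -⟩ <;> trivial

theorem LockRMW.loc (h : C.LockRMW τ k l) : l.loc = some .lock := by
  rcases h with ⟨o, pred, rfl, -⟩ | ⟨o, rfl, -⟩ <;> rfl

theorem lock_writes (C : ClientGraph G β n) (h : G.Writes w .lock v) :
    (v = 0 ∧ w = .init .lock) ∨ ∃ k τ l, w = .act k τ l ∧ C.LockRMW τ k l := by
  cases w with
  | init x =>
    cases h.loc
    exact .inl ⟨(Option.some.inj h.valw).symm, rfl⟩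
  | act k τ l =>
    refine .inr ⟨k, τ, l, rfl, ?_⟩
    obtain ⟨q, hq⟩ := C.exists_at_of_writes h (by simp)
    have hst := hq.step
    generalize (C.trace τ).pc (k + 1) = q' at hst
    cases hst with
    | swap o pred => exact .inl ⟨o, pred, rfl, hq⟩
    | casSuccess o => exact .inr ⟨o, rfl, hq⟩
    | casFail => cases h.valw
    | _ => cases h.loc

theorem next_writes {y : Val} (C : ClientGraph G β n) (h : G.Writes w (.next y) v) :
    (v = 0 ∧ (w = .init (.next y) ∨
      ∃ k τ l, y = n τ ∧ w = .act k τ l ∧ C.At τ .clearNext k l)) ∨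
    ∃ k τ l, v = n τ ∧ w = .act k τ l ∧ C.At τ (.link y) k l := by
  cases w with
  | init x =>
    cases h.loc
    exact .inl ⟨(Option.some.inj h.valw).symm, .inl rfl⟩
  | act k τ l =>
    obtain ⟨q, hq⟩ := C.exists_at_of_writes h (by simp)
    have hst := hq.step
    have hv := h.valw
    have hx := h.loc
    generalize (C.trace τ).pc (k + 1) = q' at hst
    cases hst with
    | clearNext o =>
      cases hx
      exact .inl ⟨(Option.some.inj hv).symm, .inr ⟨k, τ, _, rfl, rfl, hq⟩⟩
    | link o pred =>
      cases hx
      exact .inr ⟨k, τ, _, (Option.some.inj hv).symm, rfl, hq⟩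
    | readNext | awaitNext => cases hv
    | _ => cases hx

theorem locked_writes_one {y : Val} (C : ClientGraph G β n) (h : G.Writes w (.locked y) 1) :
    ∃ k τ l, y = n τ ∧ w = .act k τ l ∧ C.At τ .setLocked k l := by
  cases w with
  | init x => cases h.valw
  | act k τ l =>
    obtain ⟨q, hq⟩ := C.exists_at_of_writes h (by simp)
    have hst := hq.step
    have hv := h.valw
    have hx := h.loc
    generalize (C.trace τ).pc (k + 1) = q' at hst
    cases hst with
    | setLocked o =>
      cases hx
      exact ⟨k, τ, _, rfl, rfl, hq⟩
    | handOver | spin => cases hv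
    | _ => cases hx

end Accesses

section Lock

variable {τ τ' : Tid} {j j' k : ℕ} {l l' : Lab Acc Fen} {o : Acc} {v : Val} {r : Event Acc Fen}

theorem writes_of_swap (h : C.At τ .swap k l) : G.Writes (.act k τ l) .lock (n τ) := by
  have hst := h.step
  generalize (C.trace τ).pc (k + 1) = q' at hst
  cases hst
  exact writes h rfl rfl

theorem swap_isU (h : C.At τ .swap k l) : (Event.act k τ l).IsU := by
  have hst := h.step
  generalize (C.trace τ).pc (k + 1) = q' at hst
  cases hst
  trivial

theorem exists_rf_swap (hr : r ∈ G.E) (hx : r.loc = some .lock) (hv : r.valr = some v)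
    (hv₀ : v ≠ 0) : ∃ k τ l, v = n τ ∧ C.At τ .swap k l ∧ G.rf (.act k τ l) r := by
  obtain ⟨w, hw, hwr⟩ := ExecGraph.exists_rf_writes hr hx hv
  rcases C.lock_writes hwr with ⟨h₀, -⟩ | ⟨k, τ, l, rfl, ⟨o, pred, rfl, hs⟩ | ⟨o, rfl, -⟩⟩
  · exact absurd h₀ hv₀
  · exact ⟨k, τ, _, (Option.some.inj hwr.valw).symm, hs, hw⟩
  · exact absurd (Option.some.inj hwr.valw).symm hv₀

theorem rf_cas (hs : C.At τ .swap j l) (hc : C.At τ .cas k (.U o .lock (n τ) 0)) :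
    G.rf (.act j τ l) (.act k τ (.U o .lock (n τ) 0)) := by
  obtain ⟨j', τ', l', hn, hs', hrf⟩ := C.exists_rf_swap (mem hc) rfl rfl (C.node_ne τ)
  obtain rfl := C.node_inj hn
  obtain ⟨rfl, rfl⟩ := hs.unique hs' id
  exact hrf

theorem casFail_source (hG : G.Coherent hb) (hτ : τ' ≠ τ) (hs : C.At τ .swap j l)
    (hc : C.At τ .cas k (.R o .lock v)) : ∃ k' l', C.LockRMW τ' k' l' ∧
      G.rf (.act k' τ' l') (.act k τ (.R o .lock v)) ∧ G.mo (.act j τ l) (.act k' τ' l') := by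
  have hv : n τ ≠ v := by
    have hst := hc.step
    generalize (C.trace τ).pc (k + 1) = q' at hst
    cases hst with | casFail _ _ hv => exact hv.symm
  obtain ⟨w, hw, hwr⟩ := ExecGraph.exists_rf_writes (mem hc) rfl rfl
  have hne : .act j τ l ≠ w := by
    rintro rfl
    exact hv (Option.some.inj ((writes_of_swap hs).valw.symm.trans hwr.valw))
  have hmo : G.mo (.act j τ l) w := by
    refine ((writes_of_swap hs).mo_or_mo hwr hne).resolve_right fun hmo => ?_
    refine hG.not_fr_of_po (po_of_rank_lt hs hc (by simp [PC.rank])) ⟨⟨w, hw, hmo⟩, ?_⟩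
    rintro ⟨⟩
    cases (writes_of_swap hs).valw
  rcases C.lock_writes hwr with ⟨-, rfl⟩ | ⟨k', σ, l', rfl, hrmw⟩
  · exact absurd hmo (hG.not_mo_of_hb (hG.hb_of_po (po_init hs _)))
  · have hσ : σ ≠ τ := by
      rintro rfl
      rcases hrmw with ⟨-, -, -, hs'⟩ | ⟨o', rfl, hc'⟩
      · obtain ⟨rfl, rfl⟩ := hs.unique hs' id
        exact hne rfl
      · cases (hc.unique hc' id).2
    obtain rfl := Tid.eq_of_ne hσ hτ
    exact ⟨k', l', hrmw, hw, hmo⟩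

theorem mo_of_casFail (hG : G.Coherent hb) (hτ : τ' ≠ τ) (hs : C.At τ .swap j l)
    (hs' : C.At τ' .swap j' l') (hc : C.At τ .cas k (.R o .lock v)) :
    G.mo (.act j τ l) (.act j' τ' l') := by
  obtain ⟨k', l'', hrmw, -, hmo⟩ := casFail_source hG hτ hs hc
  rcases hrmw with ⟨-, -, -, hs''⟩ | ⟨o', rfl, hc'⟩
  · obtain ⟨rfl, rfl⟩ := hs'.unique hs'' id
    exact hmo
  · refine ((writes_of_swap hs).mo_or_mo (writes_of_swap hs') ?_).resolve_right
      fun hmo' => hG.not_mo_of_rf_of_mo (rf_cas hs' hc') hmo' hmo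
    rintro ⟨⟩
    exact hτ rfl

theorem rf_of_casFail (hG : G.Coherent hb) (hτ : τ' ≠ τ) (hs : C.At τ .swap j l)
    (hs' : C.At τ' .swap j' l') (hc : C.At τ .cas k (.R o .lock v)) :
    G.rf (.act j τ l) (.act j' τ' l') := by
  have hmo := mo_of_casFail hG hτ hs hs' hc
  have hst := hs'.step
  generalize (C.trace τ').pc (j' + 1) = q' at hst
  cases hst
  obtain ⟨w, hw, hwr⟩ := ExecGraph.exists_rf_writes (mem hs') rfl rfl
  rcases C.lock_writes hwr with ⟨-, rfl⟩ | ⟨k', σ, l'', rfl, hrmw⟩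
  · refine absurd hmo (hG.not_mo_of_rf_of_mo hw ?_)
    exact hG.mo_of_hb (G.writes_init _) (writes_of_swap hs) (C.node_ne τ).symm
      (hG.hb_of_po (po_init hs _))
  by_cases hσ : σ = τ
  · subst hσ
    rcases hrmw with ⟨-, -, -, hs''⟩ | ⟨o', rfl, hc'⟩
    · obtain ⟨rfl, rfl⟩ := hs.unique hs'' id
      exact hw
    · cases (hc.unique hc' id).2
  · obtain rfl := Tid.eq_of_ne hσ hτ
    rcases hrmw with ⟨-, -, -, hs''⟩ | ⟨o', rfl, hc'⟩
    · obtain ⟨rfl, rfl⟩ := hs'.unique hs'' id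
      exact absurd hw (hG.rf_asymm hw)
    · exact absurd hw (hG.rf_asymm (rf_cas hs' hc'))

theorem hb_of_casFail (hC : C.Synchronizes hb) (hτ : τ' ≠ τ) (hs : C.At τ .swap j l)
    (hs' : C.At τ' .swap j' l') (hc : C.At τ .cas k (.R o .lock v)) :
    hb (.act j' τ' l') (.act k τ (.R o .lock v)) := by
  obtain ⟨k', l'', hrmw, hrf, -⟩ := casFail_source hC.toCoherent hτ hs hc
  have hhb := hC.hb_of_lock hrf hrmw.isU hrmw.loc
  rcases hrmw with ⟨-, -, -, hs''⟩ | ⟨o', rfl, hc'⟩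
  · obtain ⟨rfl, rfl⟩ := hs'.unique hs'' id
    exact hhb
  · exact hC.hb_trans (hC.hb_of_po (po_of_rank_lt hs' hc' (by simp [PC.rank]))) hhb

end Lock

section Loops

variable {τ τ' : Tid} {i j j' k m : ℕ} {l l' : Lab Acc Fen} {o : Acc} {v pred succ : Val}

theorem enqueued (C : ClientGraph G β n) (τ : Tid) : ∃ pred, (C.trace τ).Enqueued pred := by
  rcases (C.trace τ).outcome with ⟨-, h, -⟩ | ⟨⟨pred, -, h⟩, -⟩ | ⟨⟨h, -⟩, -⟩
  exacts [h, ⟨pred, h⟩, h]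

theorem exists_swap (C : ClientGraph G β n) (τ : Tid) : ∃ k l, C.At τ .swap k l := by
  obtain ⟨_, ⟨-, -, k, o, h⟩, -⟩ := C.enqueued τ
  exact ⟨k, _, h⟩

theorem writes_of_link (h : C.At τ (.link pred) k l) :
    G.Writes (.act k τ l) (.next pred) (n τ) := by
  have hst := h.step
  generalize (C.trace τ).pc (k + 1) = q' at hst
  cases hst
  exact writes h rfl rfl

theorem swap_rf_of_pred_ne_zero (hG : G.Coherent hb) (hτ : τ' ≠ τ)
    (hs : C.At τ .swap j (.U o .lock pred (n τ))) (hs' : C.At τ' .swap j' l') (hpred : pred ≠ 0) :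
    pred = n τ' ∧ G.rf (.act j' τ' l') (.act j τ (.U o .lock pred (n τ))) := by
  obtain ⟨k, σ, l, hσ, hk, hrf⟩ := C.exists_rf_swap (mem hs) rfl rfl hpred
  have hne : σ ≠ τ := by
    rintro rfl
    obtain ⟨rfl, rfl⟩ := hs.unique hk id
    exact hG.rf_asymm hrf hrf
  obtain rfl := Tid.eq_of_ne hne hτ
  obtain ⟨rfl, rfl⟩ := hs'.unique hk id
  exact ⟨hσ, hrf⟩

theorem link_pred_eq (hG : G.Coherent hb) (hτ : τ' ≠ τ) (h : C.At τ (.link pred) k l) :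
    pred = n τ' := by
  obtain ⟨hpred, -, -, j, o, hs⟩ := h.past
  obtain ⟨j', l', hs'⟩ := C.exists_swap τ'
  exact (swap_rf_of_pred_ne_zero hG hτ hs hs' hpred).1

theorem exists_link_of_casFail (hC : C.Synchronizes hb) (hτ : τ' ≠ τ)
    (hclear : C.At τ .clearNext i l) (hs : C.At τ .swap j l') (hc : C.At τ .cas k (.R o .lock v)) :
    ∃ m l'', C.At τ' (.link (n τ)) m l'' ∧ hb (.act i τ l) (.act m τ' l'') := by
  obtain ⟨pred, ⟨-, -, j', o', hs'⟩, hlink⟩ := C.enqueued τ'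
  have hrf := rf_of_casFail hC.toCoherent hτ hs hs' hc
  obtain rfl : n τ = pred :=
    Option.some.inj ((writes_of_swap hs).valw.symm.trans (G.rf_dom _ _ hrf).2.2.2.2.2)
  obtain ⟨m, o'', hm⟩ := hlink.resolve_left (C.node_ne τ)
  exact ⟨m, _, hm, hC.hb_trans (hC.hb_of_po (po_of_rank_lt hclear hs (by simp [PC.rank])))
    (hC.hb_trans (hC.hb_of_lock hrf (swap_isU hs) (writes_of_swap hs).loc)
      (hC.hb_of_po (po_of_rank_lt hs' hm (by simp [PC.rank]))))⟩

theorem not_stuckAt_awaitNext (hC : C.Synchronizes hb) (hpast : (C.trace τ).Past .awaitNext) :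
    ¬ (C.trace τ).StuckAt .awaitNext (.R · (.next (n τ)) 0) := by
  obtain ⟨⟨pred, ⟨-, ⟨i, oi, hclear⟩, j, oj, hs⟩, -⟩, v, -, k, ok, hc⟩ := hpast
  obtain ⟨τ', hτ⟩ := exists_ne τ
  obtain ⟨m, l, hm, hhb⟩ := exists_link_of_casFail hC hτ hclear hs hc
  have hmo : ∀ w, G.Writes w (.next (n τ)) 0 → G.mo w (.act m τ' l) := by
    intro w hw
    refine hC.mo_of_hb hw (writes_of_link hm) (C.node_ne τ').symm ?_
    rcases C.next_writes hw with ⟨-, rfl | ⟨i', σ, l', hσ, rfl, h⟩⟩ | ⟨i', σ, l', h₀, -, -⟩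
    · exact hC.hb_of_po (po_init hm _)
    · obtain rfl := C.node_inj hσ
      obtain ⟨rfl, rfl⟩ := h.unique hclear id
      exact hhb
    · exact absurd h₀.symm (C.node_ne σ)
  rintro ⟨k₀, hstuck⟩
  refine C.fair.not_eventually_fr (mem hm) τ k₀ fun k hk => ?_
  obtain ⟨o, hread⟩ := hstuck k hk
  obtain ⟨w, hrf, hw⟩ := ExecGraph.exists_rf_writes (mem hread) rfl rfl
  refine ⟨_, ⟨w, hrf, hmo w hw⟩, ?_⟩
  rintro ⟨⟩
  exact hτ rfl

theorem exists_handOver_of_pred_ne_zero (hC : C.Synchronizes hb) (hτ : τ' ≠ τ)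
    (hs : C.At τ .swap j (.U o .lock pred (n τ))) (hpred : pred ≠ 0) :
    ∃ succ ≠ 0, (C.trace τ').ReadsSucc succ ∧
      (C.trace τ').Passes (.handOver succ) (.W · (.locked succ) 0) := by
  obtain ⟨j', l', hs'⟩ := C.exists_swap τ'
  have hrf := (swap_rf_of_pred_ne_zero hC.toCoherent hτ hs hs' hpred).2
  rcases (C.trace τ').outcome with ⟨-, -, h⟩ | ⟨⟨pred', hpred', ⟨-, -, k, o', hk⟩, -⟩, -⟩ | ⟨hp, h⟩
  · refine h.resolve_left ?_
    rintro ⟨k, o', hc⟩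
    have heq := hC.rmw_unique hrf (rf_cas hs' hc) trivial trivial
    injection heq with _ heq
    exact hτ heq.symm
  · obtain ⟨rfl, rfl⟩ := hs'.unique hk id
    exact absurd hrf (hC.rf_asymm
      (swap_rf_of_pred_ne_zero hC.toCoherent hτ.symm hk hs hpred').2)
  · exact absurd h (not_stuckAt_awaitNext hC hp)

theorem exists_link_rf (hG : G.Coherent hb) (hτ : τ' ≠ τ) (hr : Event.act k τ l ∈ G.E)
    (hx : l.loc = some (.next (n τ))) (hv : l.valr = some succ) (hsucc : succ ≠ 0) :
    succ = n τ' ∧ ∃ j l', C.At τ' (.link (n τ)) j l' ∧ G.rf (.act j τ' l') (.act k τ l) := by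
  obtain ⟨w, hrf, hw⟩ := ExecGraph.exists_rf_writes hr hx hv
  rcases C.next_writes hw with ⟨h₀, -⟩ | ⟨j, σ, l', rfl, rfl, hlink⟩
  · exact absurd h₀ hsucc
  have hσ : σ ≠ τ := by
    rintro rfl
    exact hτ (C.node_inj (link_pred_eq hG hτ hlink)).symm
  obtain rfl := Tid.eq_of_ne hσ hτ
  exact ⟨rfl, j, l', hlink, hrf⟩

theorem hb_of_readsSucc (hC : C.Synchronizes hb) (hτ : τ' ≠ τ) (hset : C.At τ .setLocked i l)
    (hread : (C.trace τ').ReadsSucc succ) (hsucc : succ ≠ 0)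
    (hm : C.At τ' (.handOver succ) m l') :
    succ = n τ ∧ hb (.act i τ l) (.act m τ' l') := by
  rcases hread with ⟨k, o, hk⟩ | ⟨⟨v, -, c, o, hc⟩, k, o', hk⟩
  · obtain ⟨rfl, j, l'', hlink, hrf⟩ :=
      exists_link_rf (C := C) hC.toCoherent hτ.symm (mem hk) rfl rfl hsucc
    exact ⟨rfl, hC.hb_of_link hset hlink hrf hk hm⟩
  · obtain ⟨rfl, -⟩ := exists_link_rf (C := C) hC.toCoherent hτ.symm (mem hk) rfl rfl hsucc
    obtain ⟨j, _, hs⟩ := C.exists_swap τ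
    obtain ⟨j', _, hs'⟩ := C.exists_swap τ'
    exact ⟨rfl, hC.hb_trans (hC.hb_of_po (po_of_rank_lt hset hs (by simp [PC.rank])))
      (hC.hb_trans (hb_of_casFail hC hτ.symm hs' hs hc)
        (hC.hb_of_po (po_of_rank_lt hc hm (by simp [PC.rank]))))⟩

theorem not_stuckAt_spin (hC : C.Synchronizes hb) (hpast : (C.trace τ).Past .spin) :
    ¬ (C.trace τ).StuckAt .spin (.R · (.locked (n τ)) 1) := by
  obtain ⟨pred, hpred, ⟨⟨i, oi, hset⟩, -, j, oj, hs⟩, -⟩ := hpast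
  obtain ⟨τ', hτ⟩ := exists_ne τ
  obtain ⟨succ, hsucc, hread, m, om, hm⟩ := exists_handOver_of_pred_ne_zero hC hτ hs hpred
  obtain ⟨rfl, hhb⟩ := hb_of_readsSucc hC hτ hset hread hsucc hm
  have hmo := hC.mo_of_hb (writes hset rfl rfl) (writes hm rfl rfl) one_ne_zero hhb
  rintro ⟨k₀, hstuck⟩
  refine C.fair.not_eventually_fr (mem hm) τ k₀ fun k hk => ?_
  obtain ⟨o, hread⟩ := hstuck k hk
  obtain ⟨w, hrf, hw⟩ := ExecGraph.exists_rf_writes (mem hread) rfl rfl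
  obtain ⟨i', σ, l, hσ, rfl, h⟩ := C.locked_writes_one hw
  obtain rfl := C.node_inj hσ
  obtain ⟨rfl, rfl⟩ := h.unique hset id
  exact ⟨_, ⟨_, hrf, hmo⟩, by simp⟩

theorem finite (hC : C.Synchronizes hb) : β.Finite := by
  intro τ
  rcases (C.trace τ).outcome with ⟨h, -⟩ | ⟨hpast, h⟩ | ⟨hpast, h⟩
  · exact h
  · exact absurd h (not_stuckAt_spin hC hpast)
  · exact absurd h (not_stuckAt_awaitNext hC hpast)

end Loops

end ClientGraph

/-! ### SC, TSO and RA -/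

theorem Event.SB.trans {Acc Fen : Type} {e₁ e₂ e₃ : Event Acc Fen} (h : e₁.SB e₂)
    (h' : e₂.SB e₃) : e₁.SB e₃ := by
  cases e₁ <;> cases e₂ <;> cases e₃ <;> simp only [Event.SB] at h h' ⊢
  exact ⟨h.1.trans h'.1, h.2.trans h'.2⟩

theorem Event.IsW.isU_of_isR {Acc Fen : Type} {e : Event Acc Fen} (hw : e.IsW) (hr : e.IsR) :
    e.IsU := by
  rcases e with _ | ⟨_, _, _ | _ | _ | _⟩ <;> trivial

theorem Event.IsW.exists_loc {Acc Fen : Type} {e : Event Acc Fen} (h : e.IsW) :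
    ∃ x, e.loc = some x := by
  rcases e with x | ⟨_, _, _ | ⟨_, x, _⟩ | ⟨_, x, _, _⟩ | _⟩
  exacts [⟨x, rfl⟩, h.elim, ⟨x, rfl⟩, ⟨x, rfl⟩, h.elim]

namespace ExecGraph

section Locations

variable {Acc Fen : Type} {G : ExecGraph Acc Fen} {e e' e₁ e₂ e₃ : Event Acc Fen}

theorem po_trans (h : G.po e₁ e₂) (h' : G.po e₂ e₃) : G.po e₁ e₃ :=
  ⟨h.1, h'.2.1, h.2.2.trans h'.2.2⟩

theorem exists_loc_of_rf (h : G.rf e e') : ∃ x, e.loc = some x ∧ e'.loc = some x := by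
  obtain ⟨-, -, hw, -, hloc, -⟩ := G.rf_dom _ _ h
  obtain ⟨x, hx⟩ := hw.exists_loc
  exact ⟨x, hx, hloc.symm.trans hx⟩

theorem exists_loc_of_mo (h : G.mo e e') : ∃ x, e.loc = some x ∧ e'.loc = some x := by
  obtain ⟨-, -, hw, -, hloc⟩ := G.mo_dom _ _ h
  obtain ⟨x, hx⟩ := hw.exists_loc
  exact ⟨x, hx, hloc.symm.trans hx⟩

theorem exists_loc_of_fr (h : G.fr e e') : ∃ x, e.loc = some x ∧ e'.loc = some x := by
  obtain ⟨⟨w, hrf, hmo⟩, -⟩ := h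
  obtain ⟨x, hx, hx'⟩ := exists_loc_of_mo hmo
  exact ⟨x, (G.rf_dom _ _ hrf).2.2.2.2.1.symm.trans hx, hx'⟩

end Locations

section Plain

variable {G : ExecGraph Unit Empty} {e e' : Event Unit Empty}

theorem coherent_hbRA (hmo : ∀ {e e'}, G.hbRA e e' → ¬ G.mo e' e)
    (hfr : ∀ {e e'}, G.po e e' → ¬ G.fr e' e)
    (heco : Irrefl (TransGen fun e e' => G.rf e e' ∨ G.mo e e' ∨ G.fr e e')) :
    G.Coherent G.hbRA where
  hb_of_po h := .single (.inl h)
  hb_trans := TransGen.trans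
  not_mo_of_hb := hmo
  not_fr_of_po := hfr
  eco_irrefl := heco

theorem RA.coherent (h : G.RA) : G.Coherent G.hbRA := by
  refine coherent_hbRA (fun hhb hmo => ?_) (fun hpo hfr => ?_) fun e he => ?_
  · obtain ⟨x, hx, hx'⟩ := exists_loc_of_mo hmo
    exact h _ (.tail (.single (.inl ⟨hhb, x, hx', hx⟩)) (.inr (.inr (.inl hmo))))
  · obtain ⟨x, hx, hx'⟩ := exists_loc_of_fr hfr
    exact h _ (.tail (.single (.inl ⟨.single (.inl hpo), x, hx', hx⟩)) (.inr (.inr (.inr hfr))))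
  · exact h e (TransGen.mono (fun _ _ => Or.inr) _ _ he)

theorem SC.coherent (h : G.SC) : G.Coherent G.hbRA := by
  refine coherent_hbRA (fun hhb hmo => ?_) (fun hpo hfr => ?_) fun e he => ?_
  · exact h _ ((TransGen.mono (fun _ _ => Or.imp_right Or.inl) _ _ hhb).tail
      (.inr (.inr (.inl hmo))))
  · exact h _ (.tail (.single (.inl hpo)) (.inr (.inr (.inr hfr))))
  · exact h e (TransGen.mono (fun _ _ => Or.inr) _ _ he)

theorem ppo_of_isW (h : G.po e e') (hw : e'.IsW) : G.ppo e e' :=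
  ⟨h, fun h' => h'.2.2 (hw.isU_of_isR h'.2.1)⟩

theorem exists_path_of_hbRA (h : G.hbRA e e') :
    ∃ r, ReflTransGen (fun d d' => G.ppo d d' ∨ G.rfe d d') e r ∧ (r = e' ∨ G.po r e') := by
  replace h := h.to_reflTransGen
  induction h with
  | refl => exact ⟨e, .refl, .inl rfl⟩
  | @tail d e' _ hstep ih =>
    obtain ⟨r, hpath, hr⟩ := ih
    have hpo : G.po d e' → G.po r e' := fun h => by
      rcases hr with rfl | hr
      exacts [h, po_trans hr h]
    by_cases hd : G.po d e'
    · exact ⟨r, hpath, .inr (hpo hd)⟩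
    have hrf := hstep.resolve_left hd
    refine ⟨e', .tail ?_ (.inr ⟨hrf, hd⟩), .inl rfl⟩
    rcases hr with rfl | hr
    · exact hpath
    · exact hpath.tail (.inl (ppo_of_isW hr (G.rf_dom _ _ hrf).2.2.1))

theorem TSO.coherent (h : G.TSO) : G.Coherent G.hbRA := by
  refine coherent_hbRA (fun {e e'} hhb hmo => ?_) (fun hpo hfr => ?_) fun e he => ?_
  · obtain ⟨r, hpath, hr⟩ := exists_path_of_hbRA hhb
    have hpath' : ReflTransGen (fun d d' => G.ppo d d' ∨ G.rfe d d') e e' := by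
      rcases hr with rfl | hr
      · exact hpath
      · exact hpath.tail (.inl (ppo_of_isW hr (G.mo_dom _ _ hmo).2.2.1))
    exact h.1 e' (.head' (.inr (.inr (.inl hmo)))
      (ReflTransGen.mono (fun _ _ => Or.imp_right Or.inl) _ _ hpath'))
  · obtain ⟨x, hx, hx'⟩ := exists_loc_of_fr hfr
    exact h.2 _ (.tail (.single (.inl ⟨hpo, x, hx', hx⟩)) (.inr (.inr (.inr hfr))))
  · exact h.2 e (TransGen.mono (fun _ _ => Or.inr) _ _ he)

end Plain

end ExecGraph

theorem ClientGraph.synchronizes_hbRA {G : ExecGraph Unit Empty} {β : Behavior Unit Empty}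
    {n : Tid → Val} (C : ClientGraph G β n) (hG : G.Coherent G.hbRA) : C.Synchronizes G.hbRA where
  toCoherent := hG
  hb_of_lock h _ _ := .single (.inr h)
  hb_of_link hi hj hrf hk hm :=
    .tail (.tail (.single (.inl (po_of_rank_lt hi hj (by simp [PC.rank])))) (.inr hrf))
      (.inl (po_of_rank_lt hk hm (by simp [PC.rank])))

/-! ### RC11 -/

theorem Mode.AtLeastRel.atLeastRlx {o : Mode} (h : o.AtLeastRel) : o.AtLeastRlx := by
  rcases h with rfl | rfl | rfl <;> exact Mode.noConfusion

theorem Mode.AtLeastAcq.atLeastRlx {o : Mode} (h : o.AtLeastAcq) : o.AtLeastRlx := by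
  rcases h with rfl | rfl | rfl <;> exact Mode.noConfusion

namespace ExecGraph

variable {G : ExecGraph Mode Mode} {w r f g : Event Mode Mode}

theorem RC11.coherent (h : G.RC11) : G.Coherent G.hb where
  hb_of_po hpo := .single (.inl hpo)
  hb_trans := TransGen.trans
  not_mo_of_hb hhb hmo := h.coherence _ ⟨_, hhb, .single (.single (.inr (.inl hmo)))⟩
  not_fr_of_po hpo hfr :=
    h.coherence _ ⟨_, .single (.inl hpo), .single (.single (.inr (.inr hfr)))⟩
  eco_irrefl := h.atomicity

theorem rs_self (hw : w.IsW) (h : w.mode.AtLeastRlx) : G.rs w w :=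
  ⟨w, ⟨rfl, hw⟩, w, .refl, w, ⟨rfl, hw, h⟩, .refl⟩

theorem sw_of_rf (h : G.rf w r) (hw : w.mode.AtLeastRel) (hr : r.mode.AtLeastAcq) : G.sw w r := by
  obtain ⟨-, -, hW, hR, -, -⟩ := G.rf_dom _ _ h
  exact ⟨w, ⟨rfl, hw⟩, w, .refl, w, rs_self hW hw.atLeastRlx, r, h, r, ⟨rfl, hR, hr.atLeastRlx⟩,
    r, .refl, rfl, hr⟩

theorem sw_of_fences (h : G.rf w r) (hw : w.mode.AtLeastRlx) (hr : r.mode.AtLeastRlx)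
    (hf : f.IsF) (hrel : f.mode.AtLeastRel) (hfw : G.po f w)
    (hg : g.IsF) (hacq : g.mode.AtLeastAcq) (hrg : G.po r g) : G.sw f g := by
  obtain ⟨-, -, hW, hR, -, -⟩ := G.rf_dom _ _ h
  exact ⟨f, ⟨rfl, hrel⟩, w, .single ⟨f, ⟨rfl, hf⟩, hfw⟩, w, rs_self hW hw, r, h, r, ⟨rfl, hR, hr⟩,
    g, .single ⟨g, hrg, rfl, hg⟩, rfl, hacq⟩

end ExecGraph

theorem Step.mode_U {fenced : Bool} {n v v' : Val} {q q' : PC} {o : Mode} {x : Loc}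
    (h : Step fenced n q (.U o x v v') q') : o = .acqrel := by
  cases h <;> rfl

theorem Step.mode_R_lock {fenced : Bool} {n v : Val} {q q' : PC} {o : Mode}
    (h : Step fenced n q (.R o .lock v) q') : o = .acq := by
  cases h
  rfl

namespace ThreadTrace

variable {n : Val} {σ : Stream'.Seq CLab} {T : ThreadTrace n σ} {q : PC} {i j k m : ℕ}
  {l l' : CLab}

theorem At.pc_eq (hT : T.IsExact) (h : T.At q k l) : T.pc k = q := by
  have hs := hT k l h.get
  have hst := h.step
  have hskip := h.skip_eq
  generalize T.pc k = p, T.pc (k + 1) = p' at hs hst hskip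
  cases hs <;> first | exact hskip | cases hst

theorem At.step_of_pc_ne (hT : T.IsExact) (h : T.At q k l) (hjk : j ≤ k) (hj : T.pc j ≠ q) :
    j < k ∧ ∃ l', σ.get? j = some l' ∧ Step true n (T.pc j) l' (T.pc (j + 1)) := by
  have hlt : j < k := hjk.lt_of_ne (by rintro rfl; exact hj (h.pc_eq hT))
  obtain ⟨l', hl'⟩ := Option.ne_none_iff_exists'.mp (get_ne_none_of_lt h.get hlt)
  exact ⟨hlt, l', hl', hT j l' hl'⟩

theorem exists_fence_before_link (hT : T.IsExact) {pred : Val}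
    (hi : T.At .setLocked i l) (hj : T.At (.link pred) j l') :
    ∃ f, i < f ∧ f < j ∧ σ.get? f = some (.F .rel) := by
  have hij := hi.lt_of_rank_lt hj (by simp [PC.rank])
  have hpc₁ : T.pc (i + 1) = .clearNext := by
    have hs := hT i l hi.get
    rw [hi.pc_eq hT] at hs
    generalize T.pc (i + 1) = p at hs
    cases hs
    rfl
  obtain ⟨hij₁, l₁, -, hs₁⟩ := hj.step_of_pc_ne hT hij (by simp [hpc₁])
  have hpc₂ : T.pc (i + 1 + 1) = .lockFenceRel := by
    rw [hpc₁] at hs₁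
    generalize T.pc (i + 1 + 1) = p at hs₁
    cases hs₁
    rfl
  obtain ⟨hij₂, l₂, hl₂, hs₂⟩ := hj.step_of_pc_ne hT hij₁ (by simp [hpc₂])
  rw [hpc₂] at hs₂
  generalize T.pc (i + 1 + 1 + 1) = p at hs₂
  cases hs₂
  exact ⟨i + 1 + 1, by lia, hij₂, hl₂⟩

theorem exists_fence_after_readNext (hT : T.IsExact) {succ : Val}
    (hk : T.At .readNext k l) (hm : T.At (.handOver succ) m l') :
    ∃ f, k < f ∧ f < m ∧ σ.get? f = some (.F .acq) := by
  have hkm := hk.lt_of_rank_lt hm (by simp [PC.rank])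
  obtain ⟨v, hpc⟩ : ∃ v, T.pc (k + 1) = .unlockFenceAcq v := by
    have hs := hT k l hk.get
    rw [hk.pc_eq hT] at hs
    generalize T.pc (k + 1) = p at hs
    cases hs
    exact ⟨_, rfl⟩
  obtain ⟨hkm₁, l₁, hl₁, hs₁⟩ := hm.step_of_pc_ne hT hkm (by simp [hpc])
  rw [hpc] at hs₁
  generalize T.pc (k + 1 + 1) = p at hs₁
  cases hs₁
  exact ⟨k + 1, k.lt_succ_self, hkm₁, hl₁⟩

end ThreadTrace

namespace ClientGraph

variable {G : ExecGraph Mode Mode} {β : Behavior Mode Mode} {n : Tid → Val}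
  {C : ClientGraph G β n}

theorem hb_of_lock (hT : ∀ τ, (C.trace τ).IsExact)
    {w r : Event Mode Mode} (hrf : G.rf w r) (hw : w.IsU) (hx : w.loc = some .lock) :
    G.hb w r := by
  obtain ⟨hwE, hrE, -, hr, hloc, -⟩ := G.rf_dom _ _ hrf
  refine .single (.inr (ExecGraph.sw_of_rf hrf ?_ ?_))
  · rcases w with _ | ⟨k, τ, _ | _ | _ | _⟩
    case act.U => exact .inr (.inl (hT τ k _ (C.mem_iff.mp hwE)).mode_U)
    all_goals exact hw.elim
  · rcases r with _ | ⟨k, τ, _ | _ | _ | _⟩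
    case act.R =>
      cases hloc.symm.trans hx
      exact .inl (hT τ k _ (C.mem_iff.mp hrE)).mode_R_lock
    case act.U => exact .inr (.inl (hT τ k _ (C.mem_iff.mp hrE)).mode_U)
    all_goals exact hr.elim

theorem hb_of_link (hT : ∀ τ, (C.trace τ).IsExact)
    {τ τ' : Tid} {i j k m : ℕ} {pred succ : Val} {l lw lr l' : CLab}
    (hi : C.At τ .setLocked i l) (hj : C.At τ (.link pred) j lw)
    (hrf : G.rf (.act j τ lw) (.act k τ' lr)) (hk : C.At τ' .readNext k lr)
    (hm : C.At τ' (.handOver succ) m l') : G.hb (.act i τ l) (.act m τ' l') := by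
  obtain ⟨f, hif, hfj, hf⟩ := ThreadTrace.exists_fence_before_link (hT τ) hi hj
  obtain ⟨g, hkg, hgm, hg⟩ := ThreadTrace.exists_fence_after_readNext (hT τ') hk hm
  replace hf := C.mem_iff.mpr hf
  replace hg := C.mem_iff.mpr hg
  have hrlx : (Event.act j τ lw).mode.AtLeastRlx := by
    have hs := hT τ j lw hj.get
    rw [hj.pc_eq (hT τ)] at hs
    generalize (C.trace τ).pc (j + 1) = p at hs
    cases hs
    exact Mode.noConfusion
  have hrlx' : (Event.act k τ' lr).mode.AtLeastRlx := by
    have hs := hT τ' k lr hk.get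
    rw [hk.pc_eq (hT τ')] at hs
    generalize (C.trace τ').pc (k + 1) = p at hs
    cases hs
    exact Mode.noConfusion
  have hsw : G.sw (.act f τ (.F .rel)) (.act g τ' (.F .acq)) :=
    ExecGraph.sw_of_fences hrf hrlx hrlx' trivial (.inl rfl) ⟨hf, mem hj, rfl, hfj⟩ trivial
      (.inl rfl) ⟨mem hk, hg, rfl, hkg⟩
  exact .tail (.tail (.single (.inl ⟨mem hi, hf, rfl, hif⟩)) (.inr hsw))
    (.inl ⟨hg, mem hm, rfl, hgm⟩)

theorem synchronizes_hb (hG : G.RC11) (hT : ∀ τ, (C.trace τ).IsExact) : C.Synchronizes G.hb where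
  toCoherent := hG.coherent
  hb_of_lock := hb_of_lock hT
  hb_of_link := hb_of_link hT

end ClientGraph

/-! ### Finiteness of the fenced client -/

section Client

variable {a b : Val}

theorem node_ne (ha : a ≠ 0) (hb : b ≠ 0) (τ : Tid) : node a b τ ≠ 0 := by
  unfold node
  split_ifs <;> assumption

theorem node_injective (hab : a ≠ b) : Function.Injective (node a b) := by
  intro τ τ' h
  unfold node at h
  split_ifs at h with hτ hτ' hτ'
  · exact hτ.trans hτ'.symm
  · exact absurd h hab
  · exact absurd h.symm hab
  · exact Tid.eq_of_ne hτ hτ'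

theorem finite_of_plain (ha : a ≠ 0) (hb : b ≠ 0) (hab : a ≠ b) {i : FenceReading}
    {β : Behavior Unit Empty} (h : β ∈ ((mcsClient true a b).plain i).behTF)
    {M : ExecGraph Unit Empty → Prop} (hM : ∀ G, M G → G.Coherent G.hbRA)
    (hβ : β ∈ behDecl (fun G => M G ∧ G.Fair)) : β.Finite := by
  obtain ⟨G, ⟨hG, hfair⟩, hE⟩ := hβ
  refine (finite_or_threadTrace_of_plain i h).elim id fun hT => ?_
  let C : ClientGraph G β (node a b) :=
    ⟨fun τ => (hT τ).some, hE, hfair, node_ne ha hb, node_injective hab⟩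
  exact ClientGraph.finite (C.synchronizes_hbRA (hM G hG))

theorem finite_of_RC11 (ha : a ≠ 0) (hb : b ≠ 0) (hab : a ≠ b) {β : Behavior Mode Mode}
    (h : β ∈ (mcsClient true a b).behTF)
    (hβ : β ∈ behDecl (fun G => G.RC11 ∧ G.Fair)) : β.Finite := by
  obtain ⟨G, ⟨hG, hfair⟩, hE⟩ := hβ
  refine (finite_or_threadTrace h).elim id fun hT => ?_
  choose T hT using hT
  let C : ClientGraph G β (node a b) := ⟨T, hE, hfair, node_ne ha hb, node_injective hab⟩
  exact ClientGraph.finite (C.synchronizes_hb hG hT)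

end Client

/-! ### Behaviors from schedules, graphs from positions -/

section Schedule

variable {Acc Fen : Type} {P : Program Acc Fen} {β : Behavior Acc Fen} {s : ∀ τ, ℕ → (P τ).Q}
  {actor : ℕ → Tid} {lab : ℕ → Lab Acc Fen}

theorem get?_ne_none_of_lt_count
    (hlab : ∀ j, (β (actor j)).get? (Nat.count (fun i => actor i = actor j) j) = some (lab j))
    {τ : Tid} {i j : ℕ} (hij : i < Nat.count (fun i => actor i = τ) j) :
    (β τ).get? i ≠ none := by
  induction j with
  | zero => simp at hij
  | succ j ih =>
    rw [Nat.count_succ] at hij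
    split_ifs at hij with hj
    · rcases Nat.lt_succ_iff_lt_or_eq.mp hij with hij | rfl
      · exact ih hij
      · simp [← hj, hlab]
    · exact ih hij

theorem LTS.IsMaximalTrace.exists_actor_eq {τ : Tid} {st : ℕ → (P τ).Q}
    (hβ : (P τ).IsMaximalTrace (β τ) st)
    (hlab : ∀ j, (β (actor j)).get? (Nat.count (fun i => actor i = actor j) j) = some (lab j))
    (hsched : ∀ k, (β τ).get? k ≠ none →
      ∃ j, actor j = τ ∧ Nat.count (fun i => actor i = τ) j = k)
    {k : ℕ} {l : Lab Acc Fen} {q : (P τ).Q}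
    (hstep : (P τ).step (st (Nat.count (fun i => actor i = τ) k)) l q) :
    ∃ j ≥ k, actor j = τ := by
  have hne : (β τ).get? (Nat.count (fun i => actor i = τ) k) ≠ none := fun h =>
    hβ.halts _ (fun _ hi => get?_ne_none_of_lt_count hlab hi) h l q hstep
  obtain ⟨j, hj, hcount⟩ := hsched _ hne
  refine ⟨j, not_lt.mp fun hjk => ?_, hj⟩
  exact (Nat.count_strict_mono (p := fun i => actor i = τ) hj hjk).ne hcount

theorem Program.mem_behTF_of_schedule (hβ : ∀ τ, (P τ).IsMaximalTrace (β τ) (s τ))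
    (hlab : ∀ j, (β (actor j)).get? (Nat.count (fun i => actor i = actor j) j) = some (lab j))
    (hsched : ∀ τ k, (β τ).get? k ≠ none →
      ∃ j, actor j = τ ∧ Nat.count (fun i => actor i = τ) j = k) :
    β ∈ P.behTF := by
  let st : ℕ → P.lts.Q := fun j τ => s τ (Nat.count (fun i => actor i = τ) j)
  let μ : Stream'.Seq (P.lts.Q × (Tid × Lab Acc Fen) × P.lts.Q) :=
    Stream'.Seq.ofStream fun j => (st j, (actor j, lab j), st (j + 1))
  have hstart : st 0 = P.lts.init := funext fun τ => by
    simp only [st, Nat.count_zero]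
    exact (hβ τ).start
  have hstep : ∀ j, P.lts.step (st j) (actor j, lab j) (st (j + 1)) := fun j => by
    constructor
    · simpa [st, Nat.count_succ] using (hβ (actor j)).step _ _ (hlab j)
    · intro π hπ
      simp [st, Nat.count_succ, hπ.symm]
  have hrun : P.lts.IsRun μ := by
    refine ⟨?_, ?_, ?_⟩
    · rintro k _ ⟨⟩
      exact hstep k
    · rintro _ ⟨⟩
      exact hstart
    · rintro k _ _ ⟨⟩ ⟨⟩
      rfl
  have hfair : P.ThreadFair μ := .inr fun τ k hen => by
    obtain ⟨l, p, hp, -⟩ := hen k le_rfl _ rfl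
    obtain ⟨j, hkj, hj⟩ := (hβ τ).exists_actor_eq hlab (hsched τ) hp
    exact ⟨j, hkj, _, rfl, hj⟩
  refine ⟨μ, hrun, hfair, (induces_iff_count (lab := fun j => (actor j, lab j)) fun _ => rfl).mpr
    fun τ k l => ⟨fun hl => ?_, ?_⟩⟩
  · obtain ⟨j, rfl, rfl⟩ := hsched τ k (by simp [hl])
    exact ⟨j, by rw [Option.some.inj ((hlab j).symm.trans hl)], rfl⟩
  · rintro ⟨j, ⟨⟩, rfl⟩
    exact hlab j

end Schedule

section Positions

variable {Acc Fen : Type} {β : Behavior Acc Fen} {pos : Event Acc Fen → ℕ}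
  {w r e e' : Event Acc Fen}

/-- The read `r` can read from the write `w` when `pos` gives the position of every write in the
modification order, and of the write that every plain read reads from: a read-modify-write comes
immediately after the write that it reads from. -/
structure ReadsAt (pos : Event Acc Fen → ℕ) (w r : Event Acc Fen) : Prop where
  isW : w.IsW
  isR : r.IsR
  loc : w.loc = r.loc
  val : w.valw = r.valr
  pos_of_isW : r.IsW → pos r = pos w + 1
  pos_of_not_isW : ¬ r.IsW → pos r = pos w

/-- `pos` describes a modification order and a reads-from relation on the events of `β`, as in
`ReadsAt`. -/
structure IsPosition (β : Behavior Acc Fen) (pos : Event Acc Fen → ℕ) : Prop where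
  inj : ∀ w ∈ β.events, ∀ w' ∈ β.events, w.IsW → w'.IsW → w.loc = w'.loc → pos w = pos w' → w = w'
  source : ∀ r ∈ β.events, r.IsR → ∃ w ∈ β.events, ReadsAt pos w r

/-- The execution graph described by `pos`. -/
def IsPosition.graph (h : IsPosition β pos) : ExecGraph Acc Fen where
  E := β.events
  rf w r := w ∈ β.events ∧ r ∈ β.events ∧ ReadsAt pos w r
  mo w w' := w ∈ β.events ∧ w' ∈ β.events ∧ w.IsW ∧ w'.IsW ∧ w.loc = w'.loc ∧ pos w < pos w'
  init_mem x := .inl ⟨x, rfl⟩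
  sn_unique k τ l l' hl hl' := Option.some.inj <|
    (Behavior.act_mem_events.mp hl).symm.trans (Behavior.act_mem_events.mp hl')
  sn_closed k τ l hl j hj := by
    obtain ⟨l', hl'⟩ := (β τ).ge_stable hj.le (Behavior.act_mem_events.mp hl)
    exact ⟨l', Behavior.act_mem_events.mpr hl'⟩
  rf_dom _ _ := fun ⟨hw, hr, h⟩ => ⟨hw, hr, h.isW, h.isR, h.loc, h.val⟩
  rf_functional w w' r := fun ⟨hw, _, hwr⟩ ⟨hw', _, hwr'⟩ => by
    refine h.inj w hw w' hw' hwr.isW hwr'.isW (hwr.loc.trans hwr'.loc.symm) ?_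
    by_cases hr : r.IsW
    · exact Nat.succ.inj ((hwr.pos_of_isW hr).symm.trans (hwr'.pos_of_isW hr))
    · exact (hwr.pos_of_not_isW hr).symm.trans (hwr'.pos_of_not_isW hr)
  rf_total r hr hR := by
    obtain ⟨w, hw, hwr⟩ := h.source r hr hR
    exact ⟨w, hw, hr, hwr⟩
  mo_dom _ _ := fun ⟨hw, hw', hW, hW', hloc, _⟩ => ⟨hw, hw', hW, hW', hloc⟩
  mo_irrefl _ := fun ⟨_, _, _, _, _, hlt⟩ => hlt.false
  mo_trans _ _ _ := fun ⟨h₁, _, hW₁, _, hloc, hlt⟩ ⟨_, h₃, _, hW₃, hloc', hlt'⟩ =>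
    ⟨h₁, h₃, hW₁, hW₃, hloc.trans hloc', hlt.trans hlt'⟩
  mo_total w hw w' hw' hW hW' hloc hne :=
    (lt_or_gt_of_ne fun hpos => hne (h.inj w hw w' hw' hW hW' hloc hpos)).imp
      (fun hlt => ⟨hw, hw', hW, hW', hloc, hlt⟩) fun hlt => ⟨hw', hw, hW', hW, hloc.symm, hlt⟩

open Classical in
/-- The rank of an event in the extended coherence order: a plain read comes between the write that
it reads from and the next write. -/
noncomputable def ecoRank (pos : Event Acc Fen → ℕ) (e : Event Acc Fen) : ℕ :=
  2 * pos e + if e.IsW then 0 else 1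

namespace IsPosition

theorem ecoRank_lt (h : IsPosition β pos)
    (he : h.graph.rf e e' ∨ h.graph.mo e e' ∨ h.graph.fr e e') :
    ecoRank pos e < ecoRank pos e' := by
  rcases he with ⟨-, -, hr⟩ | ⟨-, -, hW, hW', -, hlt⟩ | ⟨⟨w, ⟨-, heE, hr⟩, hmo⟩, hne⟩
  · unfold ecoRank
    rw [if_pos hr.isW, add_zero]
    split_ifs with hW'
    · have := hr.pos_of_isW hW'
      omega
    · have := hr.pos_of_not_isW hW'
      omega
  · simpa [ecoRank, hW, hW'] using hlt
  · obtain ⟨-, heE', -, hW', hloc, hlt⟩ := hmo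
    unfold ecoRank
    rw [if_pos hW', add_zero]
    split_ifs with heW
    · have hpos := hr.pos_of_isW heW
      have : pos e ≠ pos e' := fun heq =>
        hne (h.inj e heE e' heE' heW hW' (hr.loc.symm.trans hloc) heq)
      omega
    · have := hr.pos_of_not_isW heW
      omega

theorem fair (h : IsPosition β pos) (hfin : ∀ w ∈ β.events, w.IsW →
    {e ∈ β.events | e.loc = w.loc ∧ ecoRank pos e < ecoRank pos w}.Finite) : h.graph.Fair := by
  constructor
  · intro w hw
    by_cases hW : w.IsW
    · refine (hfin w hw hW).subset fun e hmo => ?_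
      exact ⟨hmo.1, hmo.2.2.2.2.1, h.ecoRank_lt (.inr (.inl hmo))⟩
    · exact Set.finite_empty.subset fun e hmo => hW hmo.2.2.2.1
  · intro w hw
    by_cases hW : w.IsW
    · refine (hfin w hw hW).subset fun e hfr => ⟨?_, ?_, h.ecoRank_lt (.inr (.inr hfr))⟩
      · obtain ⟨⟨_, hrf, -⟩, -⟩ := hfr
        exact hrf.2.1
      · obtain ⟨⟨_, hrf, hmo⟩, -⟩ := hfr
        exact hrf.2.2.loc.symm.trans hmo.2.2.2.2.1
    · exact Set.finite_empty.subset fun e ⟨⟨_, _, hmo⟩, _⟩ => hW hmo.2.2.2.1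

end IsPosition

theorem finite_setOf_act_lt (β : Behavior Acc Fen) (n : ℕ) :
    {e | ∃ k < n, ∃ τ l, .act k τ l ∈ β.events ∧ e = Event.act k τ l}.Finite := by
  let event (p : ℕ × Tid) : Event Acc Fen := ((β p.2).get? p.1).elim (.init .lock) (.act p.1 p.2)
  refine (((Set.finite_Iio n).prod Set.finite_univ).image event).subset ?_
  rintro _ ⟨k, hk, τ, l, hl, rfl⟩
  exact ⟨(k, τ), ⟨hk, trivial⟩, by simp [event, Behavior.act_mem_events.mp hl]⟩

end Positions

theorem lt_of_transGen {α : Type*} {r : α → α → Prop} {f : α → ℕ}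
    (hf : ∀ x y, r x y → f x < f y) {x y : α} (h : TransGen r x y) : f x < f y :=
  TransGen.trans_induction_on h (hf _ _) fun _ _ => lt_trans

namespace ExecGraph

variable {G : ExecGraph Mode Mode} {e e' : Event Mode Mode}

theorem exists_loc_of_eco (h : G.eco e e') : ∃ x, e.loc = some x ∧ e'.loc = some x := by
  induction h with
  | single h => exact h.elim exists_loc_of_rf (Or.elim · exists_loc_of_mo exists_loc_of_fr)
  | tail _ h ih =>
    obtain ⟨x, he, hx⟩ := ih
    obtain ⟨y, hy, he'⟩ := h.elim exists_loc_of_rf (Or.elim · exists_loc_of_mo exists_loc_of_fr)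
    exact ⟨x, he, he'.trans (hy.symm.trans hx)⟩

theorem reflTransGen_of_rs (h : G.rs e e') :
    ReflTransGen (fun e e' => G.po e e' ∨ G.rf e e') e e' := by
  obtain ⟨_, ⟨rfl, -⟩, w, hpo, _, ⟨rfl, -⟩, hrf⟩ := h
  have hwe' : ReflTransGen (fun e e' => G.po e e' ∨ G.rf e e') w e' :=
    ReflTransGen.mono (fun _ _ ⟨_, hrf, heq, _⟩ => .inr (heq ▸ hrf)) _ _ hrf
  cases hpo with
  | refl => exact hwe'
  | single hpo => exact .head (.inl hpo.1) hwe'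

theorem transGen_of_sw (h : G.sw e e') : TransGen (fun e e' => G.po e e' ∨ G.rf e e') e e' := by
  obtain ⟨_, ⟨rfl, -⟩, w₀, hpo, w, hrs, r, hrf, _, ⟨rfl, -⟩, e'', hpo', rfl, -⟩ := h
  have hw : ReflTransGen (fun e e' => G.po e e' ∨ G.rf e e') e w := by
    cases hpo with
    | refl => exact reflTransGen_of_rs hrs
    | single hpo =>
      obtain ⟨_, ⟨rfl, -⟩, hpo⟩ := hpo
      exact .head (.inl hpo) (reflTransGen_of_rs hrs)
  have hr : TransGen (fun e e' => G.po e e' ∨ G.rf e e') e r := .tail' hw (.inr hrf)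
  cases hpo' with
  | refl => exact hr
  | single hpo' =>
    obtain ⟨_, hpo', rfl, -⟩ := hpo'
    exact hr.tail (.inl hpo')

theorem transGen_of_hb (h : G.hb e e') : TransGen (fun e e' => G.po e e' ∨ G.rf e e') e e' := by
  induction h with
  | single h => exact h.elim (fun h => .single (.inl h)) transGen_of_sw
  | tail _ h ih => exact ih.trans (h.elim (fun h => .single (.inl h)) transGen_of_sw)

theorem mem_of_hb (h : G.hb e e') : e ∈ G.E ∧ e' ∈ G.E := by
  refine TransGen.trans_induction_on (transGen_of_hb h) (fun h => h.elim ?_ ?_)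
    fun _ _ h h' => ⟨h.1, h'.2⟩
  · exact fun h => ⟨h.1, h.2.1⟩
  · exact fun h => ⟨(G.rf_dom _ _ h).1, (G.rf_dom _ _ h).2.1⟩

theorem mem_of_scb (h : G.scb e e') : e ∈ G.E := by
  rcases h with h | ⟨_, h, -⟩ | h | h | ⟨⟨_, h, -⟩, -⟩
  · exact h.1
  · exact h.1.1
  · exact (mem_of_hb h.1).1
  · exact (G.mo_dom _ _ h).1
  · exact (G.rf_dom _ _ h).2.1

theorem exists_mode_eq_sc (h : G.pscBase e e' ∨ G.pscF e e') : ∃ e ∈ G.E, e.mode = .sc := by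
  rcases h with ⟨e₁, hleft, e₂, hscb, -⟩ | ⟨_, ⟨rfl, -, hsc⟩, e₂, h, -⟩
  · rcases hleft with ⟨rfl, hsc⟩ | ⟨_, ⟨rfl, -, hsc⟩, hhb⟩
    · exact ⟨e, mem_of_scb hscb, hsc⟩
    · cases hhb with
      | refl => exact ⟨e, mem_of_scb hscb, hsc⟩
      | single hhb => exact ⟨e, (mem_of_hb hhb).1, hsc⟩
  · rcases h with h | ⟨_, h, -⟩ <;> exact ⟨e, (mem_of_hb h).1, hsc⟩

theorem RC11.of_monotone {time rank : Event Mode Mode → ℕ} (hsc : ∀ e ∈ G.E, e.mode ≠ .sc)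
    (htime : ∀ e e', G.po e e' ∨ G.rf e e' → time e < time e')
    (hrank : ∀ e e', G.rf e e' ∨ G.mo e e' ∨ G.fr e e' → rank e < rank e')
    (hhb : ∀ e e', sameLoc G.hb e e' → rank e ≤ rank e') : G.RC11 where
  coherence := by
    rintro e ⟨e', hb, heco⟩
    cases heco with
    | refl => exact (lt_of_transGen htime (transGen_of_hb hb)).false
    | single heco =>
      obtain ⟨x, hx', hx⟩ := exists_loc_of_eco heco
      exact (hhb e e' ⟨hb, x, hx, hx'⟩).not_gt (lt_of_transGen hrank heco)
  atomicity _ h := (lt_of_transGen hrank h).false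
  sc_order _ h := by
    obtain ⟨_, hpsc, -⟩ := TransGen.head'_iff.mp h
    obtain ⟨e, he, hmode⟩ := exists_mode_eq_sc hpsc
    exact hsc e he hmode
  no_thin_air _ h := (lt_of_transGen htime h).false

theorem exists_rf_of_sw (h : G.sw e e') (he : ¬ e.IsF) :
    ∃ w r, (w = e ∨ sameLoc G.po e w) ∧ G.rf w r := by
  obtain ⟨_, ⟨rfl, -⟩, _, hpo, w', hrs, r, hrf, -⟩ := h
  cases hpo with
  | single hpo =>
    obtain ⟨_, ⟨rfl, hF⟩, -⟩ := hpo
    exact absurd hF he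
  | refl =>
    obtain ⟨_, ⟨rfl, -⟩, w, hew, _, ⟨rfl, -⟩, hchain⟩ := hrs
    obtain ⟨r', hr'⟩ : ∃ r', G.rf w r' := by
      rcases hchain.cases_head with rfl | ⟨_, ⟨r', hr', -⟩, -⟩
      exacts [⟨r, hrf⟩, ⟨r', hr'⟩]
    cases hew with
    | refl => exact ⟨_, r', .inl rfl, hr'⟩
    | single hew => exact ⟨w, r', .inr hew, hr'⟩

end ExecGraph

/-! ### An infinite behavior of the client without the release fence -/

namespace Unfenced

variable {a b : Val}

/-- The `k`-th label of thread `τ` in the following behavior: thread `0` acquires the lock first,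
learns that thread `1` has queued up behind it and hands the lock over; thread `1` never sees this
and spins forever. -/
def label (a b : Val) : Tid → ℕ → Option CLab
  | 0, 0 => some (.W .rlx (.locked a) 1)
  | 0, 1 => some (.W .rlx (.next a) 0)
  | 0, 2 => some (.U .acqrel .lock 0 a)
  | 0, 3 => some (.F .rel)
  | 0, 4 => some (.R .rlx (.next a) b)
  | 0, 5 => some (.F .acq)
  | 0, 6 => some (.W .rlx (.locked b) 0)
  | 0, _ + 7 => none
  | 1, 0 => some (.W .rlx (.locked b) 1)
  | 1, 1 => some (.W .rlx (.next b) 0)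
  | 1, 2 => some (.U .acqrel .lock a b)
  | 1, 3 => some (.W .rlx (.next a) b)
  | 1, _ + 4 => some (.R .rlx (.locked b) 1)

/-- The program point of thread `τ` after its first `k` steps. -/
def pc (a b : Val) : Tid → ℕ → PC
  | 0, 0 => .setLocked
  | 0, 1 => .clearNext
  | 0, 2 => .swap
  | 0, 3 => .unlockFenceRel
  | 0, 4 => .readNext
  | 0, 5 => .unlockFenceAcq b
  | 0, 6 => .handOver b
  | 0, _ + 7 => .done
  | 1, 0 => .setLocked
  | 1, 1 => .clearNext
  | 1, 2 => .swap
  | 1, 3 => .link a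
  | 1, _ + 4 => .spin

/-- The behavior with the labels `label`. -/
def behavior (a b : Val) : Behavior Mode Mode := fun τ =>
  ⟨label a b τ, by
    intro k h
    fin_cases τ
    · match k, h with | _ + 7, _ => rfl
    · match k, h with | _ + 4, h => cases h⟩

theorem isMaximalTrace (ha : a ≠ 0) (hb : b ≠ 0) (τ : Tid) :
    (mcsClient false a b τ).IsMaximalTrace (behavior a b τ) (pc a b τ) where
  start := by fin_cases τ <;> rfl
  step k l hl := by
    have hswap := Step.swap (fenced := false) (n := b) a
    have hfence := Step.unlockFenceAcq (fenced := false) (n := a) b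
    rw [if_neg ha] at hswap
    rw [if_neg hb] at hfence
    fin_cases τ
    · match k, l, hl with
      | 0, _, rfl => exact .setLocked
      | 1, _, rfl => exact .clearNext
      | 2, _, rfl => exact .swap 0
      | 3, _, rfl => exact .unlockFenceRel
      | 4, _, rfl => exact .readNext b
      | 5, _, rfl => exact hfence
      | 6, _, rfl => exact .handOver b
    · match k, l, hl with
      | 0, _, rfl => exact .setLocked
      | 1, _, rfl => exact .clearNext
      | 2, _, rfl => exact hswap
      | 3, _, rfl => exact .link a
      | _ + 4, _, rfl => exact .spin 1
  halts k _ hk l q hq := by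
    fin_cases τ
    · match k, hk with
      | _ + 7, _ => cases (hq : Step false a .done l q)
    · match k, hk with
      | _ + 4, hk => cases hk

theorem behavior_mem_behTF (ha : a ≠ 0) (hb : b ≠ 0) :
    behavior a b ∈ (mcsClient false a b).behTF := by
  let actor (j : ℕ) : Tid := if j < 7 then 0 else 1
  have hcount₀ : ∀ j ≤ 7, Nat.count (fun i => actor i = 0) j = j := by
    intro j hj
    exact Nat.count_of_forall fun i hi => if_pos (hi.trans_le hj)
  have hcount₁ : ∀ j, Nat.count (fun i => actor i = 1) (7 + j) = j := by
    intro j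
    rw [Nat.count_add, Nat.count_of_forall_not, zero_add, Nat.count_of_forall]
    all_goals simp +contextual [actor]
  have hlab : ∀ j, ∃ l,
      (behavior a b (actor j)).get? (Nat.count (fun i => actor i = actor j) j) = some l := by
    intro j
    by_cases hj : j < 7
    · have hactor : actor j = 0 := if_pos hj
      rw [hactor, hcount₀ j hj.le]
      interval_cases j <;> exact ⟨_, rfl⟩
    · obtain ⟨k, rfl⟩ := Nat.exists_eq_add_of_le (not_lt.mp hj)
      have hactor : actor (7 + k) = 1 := if_neg hj
      rw [hactor, hcount₁]
      match k with
      | 0 | 1 | 2 | 3 | _ + 4 => exact ⟨_, rfl⟩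
  choose lab hlab using hlab
  refine Program.mem_behTF_of_schedule (isMaximalTrace ha hb) hlab fun τ k hk => ?_
  fin_cases τ
  · have hk7 : k < 7 := by
      by_contra! hle
      obtain ⟨k, rfl⟩ := Nat.exists_eq_add_of_le' hle
      exact hk rfl
    exact ⟨k, if_pos hk7, hcount₀ k hk7.le⟩
  · exact ⟨7 + k, if_neg (by omega), hcount₁ k⟩

theorem not_finite_behavior : ¬ (behavior a b).Finite := fun h => by
  obtain ⟨k, hk⟩ := h 1
  match k, hk with
  | 0, hk => cases hk
  | 1, hk => cases hk
  | 2, hk => cases hk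
  | 3, hk => cases hk
  | _ + 4, hk => cases hk

/-- The events of `behavior`. -/
inductive Occurs (a b : Val) : Event Mode Mode → Prop
  | init (x : Loc) : Occurs a b (.init x)
  | setLocked₀ : Occurs a b (.act 0 0 (.W .rlx (.locked a) 1))
  | clearNext₀ : Occurs a b (.act 1 0 (.W .rlx (.next a) 0))
  | swap₀ : Occurs a b (.act 2 0 (.U .acqrel .lock 0 a))
  | fenceRel : Occurs a b (.act 3 0 (.F .rel))
  | readNext : Occurs a b (.act 4 0 (.R .rlx (.next a) b))
  | fenceAcq : Occurs a b (.act 5 0 (.F .acq))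
  | handOver : Occurs a b (.act 6 0 (.W .rlx (.locked b) 0))
  | setLocked₁ : Occurs a b (.act 0 1 (.W .rlx (.locked b) 1))
  | clearNext₁ : Occurs a b (.act 1 1 (.W .rlx (.next b) 0))
  | swap₁ : Occurs a b (.act 2 1 (.U .acqrel .lock a b))
  | link : Occurs a b (.act 3 1 (.W .rlx (.next a) b))
  | spin (k : ℕ) : Occurs a b (.act (k + 4) 1 (.R .rlx (.locked b) 1))

theorem mem_events {e : Event Mode Mode} : e ∈ (behavior a b).events ↔ Occurs a b e := by
  constructor
  · rintro (⟨x, rfl⟩ | ⟨k, τ, l, hl, rfl⟩)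
    · exact .init x
    fin_cases τ
    · match k, hl with
      | 0, rfl => exact .setLocked₀
      | 1, rfl => exact .clearNext₀
      | 2, rfl => exact .swap₀
      | 3, rfl => exact .fenceRel
      | 4, rfl => exact .readNext
      | 5, rfl => exact .fenceAcq
      | 6, rfl => exact .handOver
    · match k, hl with
      | 0, rfl => exact .setLocked₁
      | 1, rfl => exact .clearNext₁
      | 2, rfl => exact .swap₁
      | 3, rfl => exact .link
      | k + 4, rfl => exact .spin k
  · rintro (x | _)
    · exact .inl ⟨x, rfl⟩
    all_goals exact .inr ⟨_, _, _, rfl, rfl⟩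

/-- The modification order and the reads-from relation of the execution, as positions. The write
that hands the lock over is placed before the write `b.locked := 1` of thread `1`. -/
def pos : Event Mode Mode → ℕ
  | .init _ => 0
  | .act k τ _ => if τ = 0 then (if k = 4 then 2 else 1) else (if k = 1 then 1 else 2)

/-- A linearization of program order and reads-from. -/
def time : Event Mode Mode → ℕ
  | .init _ => 0
  | .act k τ _ => if τ = 0 then (if k ≤ 2 then k + 1 else k + 5) else k + 4

theorem exists_readsAt {r : Event Mode Mode} (hr : r ∈ (behavior a b).events) (hR : r.IsR) :
    ∃ w ∈ (behavior a b).events, ReadsAt pos w r ∧ time w < time r := by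
  cases mem_events.mp hr with
  | swap₀ =>
    exact ⟨_, mem_events.mpr (.init .lock),
      ⟨trivial, trivial, rfl, rfl, fun _ => rfl, absurd trivial⟩, by simp [time]⟩
  | swap₁ =>
    exact ⟨_, mem_events.mpr .swap₀,
      ⟨trivial, trivial, rfl, rfl, fun _ => rfl, absurd trivial⟩, by simp [time]⟩
  | readNext =>
    exact ⟨_, mem_events.mpr .link, ⟨trivial, trivial, rfl, rfl, False.elim, fun _ => rfl⟩,
      by simp [time]⟩
  | spin k =>
    exact ⟨_, mem_events.mpr .setLocked₁,
      ⟨trivial, trivial, rfl, rfl, False.elim, fun _ => by simp [pos]⟩,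
      by simp [time]⟩
  | _ => exact hR.elim

theorem isPosition (hab : a ≠ b) : IsPosition (behavior a b) pos where
  inj w hw w' hw' hW hW' hloc hpos := by
    cases mem_events.mp hw <;> cases mem_events.mp hw' <;>
      simp_all [pos, Event.loc, Lab.loc, Event.IsW]
  source r hr hR := by
    obtain ⟨w, hw, hwr, -⟩ := exists_readsAt hr hR
    exact ⟨w, hw, hwr⟩

theorem time_lt_of_SB {e e' : Event Mode Mode} (h : e.SB e') : time e < time e' := by
  match e, e', h with
  | .init _, .act k τ _, _ => fin_cases τ <;> grind [time]
  | .act j τ _, .act k _ _, ⟨rfl, hjk⟩ => fin_cases τ <;> grind [time]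

theorem time_lt (hab : a ≠ b) {e e' : Event Mode Mode}
    (h : (isPosition hab).graph.po e e' ∨ (isPosition hab).graph.rf e e') : time e < time e' := by
  rcases h with h | h
  · exact time_lt_of_SB h.2.2
  · obtain ⟨w, hw, hwr, hlt⟩ := exists_readsAt h.2.1 h.2.2.isR
    rwa [(isPosition hab).graph.rf_functional _ _ _ h ⟨hw, h.2.1, hwr⟩]

/-- Events of the waiting thread. -/
def InThreadOne : Event Mode Mode → Prop
  | .init _ => False
  | .act _ τ _ => τ = 1

theorem InThreadOne.of_SB {e e' : Event Mode Mode} (he : InThreadOne e) (h : e.SB e') :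
    InThreadOne e' := by
  match e, e', h with
  | .act _ _ _, .act _ _ _, ⟨rfl, _⟩ => exact he

/-- The only release event of thread `1` is its swap, and no event reads from it. -/
theorem InThreadOne.not_sw (hab : a ≠ b) {e e' : Event Mode Mode} (he : InThreadOne e) :
    ¬ (isPosition hab).graph.sw e e' := by
  intro h
  have hrel : e.mode.AtLeastRel := by
    obtain ⟨_, ⟨rfl, hmode⟩, -⟩ := h
    exact hmode
  have heq : e = .act 2 1 (.U .acqrel .lock a b) := by
    cases mem_events.mp (ExecGraph.mem_of_hb (.single (.inr h))).1 <;>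
      simp_all [InThreadOne, Event.mode, Mode.AtLeastRel]
  subst heq
  obtain ⟨w, r, hw, hwE, hrE, hr⟩ := ExecGraph.exists_rf_of_sw h id
  have hweq : w = .act 2 1 (.U .acqrel .lock a b) := by
    refine hw.resolve_right ?_
    rintro ⟨⟨-, -, hsb⟩, _, ⟨⟩, hx⟩
    cases mem_events.mp hwE <;> simp_all [Event.SB, Event.loc, Lab.loc]
  subst hweq
  have hloc := hr.loc
  have hpos := hr.pos_of_isW
  have hR := hr.isR
  cases mem_events.mp hrE <;> simp_all [Event.IsW, Event.loc, Lab.loc, pos]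

theorem InThreadOne.of_hb (hab : a ≠ b) {e e' : Event Mode Mode} (he : InThreadOne e)
    (h : (isPosition hab).graph.hb e e') : InThreadOne e' := by
  induction h with
  | single h => exact h.elim (fun h => he.of_SB h.2.2) fun h => absurd h (he.not_sw hab)
  | tail _ h ih => exact h.elim (fun h => ih.of_SB h.2.2) fun h => absurd h (ih.not_sw hab)

theorem ecoRank_le_of_hb (hab : a ≠ b) {e e' : Event Mode Mode}
    (h : sameLoc (isPosition hab).graph.hb e e') : ecoRank pos e ≤ ecoRank pos e' := by
  obtain ⟨hhb, x, hx, hx'⟩ := h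
  have he : Occurs a b e := mem_events.mp (ExecGraph.mem_of_hb hhb).1
  have he' : Occurs a b e' := mem_events.mp (ExecGraph.mem_of_hb hhb).2
  have htime : time e < time e' :=
    lt_of_transGen (f := time) (fun _ _ => time_lt hab) (ExecGraph.transGen_of_hb hhb)
  -- `time` orders accesses of thread `1` to `b.locked` before the hand-over, against their rank;
  -- they do not happen before it because thread `1` never synchronizes with thread `0`.
  have hthread : InThreadOne e → InThreadOne e' := (InThreadOne.of_hb hab · hhb)
  clear hhb
  cases he <;> cases hx <;> cases he' <;>
      simp_all [InThreadOne, time, ecoRank, pos, Event.loc, Lab.loc, Event.IsW]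

theorem rc11 (hab : a ≠ b) : (isPosition hab).graph.RC11 := by
  refine .of_monotone (fun e he => ?_) (fun _ _ => time_lt hab)
    (fun _ _ => (isPosition hab).ecoRank_lt) fun _ _ => ecoRank_le_of_hb hab
  cases mem_events.mp he <;> exact Mode.noConfusion

theorem fair (hab : a ≠ b) : (isPosition hab).graph.Fair := by
  refine (isPosition hab).fair fun w hw hW => ?_
  obtain ⟨x, hx⟩ := hW.exists_loc
  have hrank : ecoRank pos w ≤ 4 := by
    cases mem_events.mp hw <;> simp_all [ecoRank, pos, Event.IsW]
  refine ((finite_setOf_act_lt (behavior a b) 7).insert (.init x)).subset ?_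
  rintro e ⟨he, hloc, hlt⟩
  cases mem_events.mp he with
  | init y =>
    cases hloc.trans hx
    exact .inl rfl
  | spin k =>
    have hspin : ecoRank pos (.act (k + 4) 1 (.R .rlx (.locked b) 1)) = 5 := by
      simp [ecoRank, pos, Event.IsW]
    omega
  | _ => exact .inr ⟨_, by decide, _, _, he, rfl⟩

end Unfenced

end FairMem

theorem theorem5p5 (a b : FairMem.Val) (ha : a ≠ 0) (hb : b ≠ 0) (hab : a ≠ b) :
    -- with the release fence, under fair SC, TSO and RA
    (∀ (i : FairMem.FenceReading) (β : FairMem.Behavior Unit Empty),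
      β ∈ ((FairMem.mcsClient true a b).plain i).behTF →
        (β ∈ FairMem.behDecl (fun G => G.SC ∧ G.Fair) → β.Finite) ∧
        (β ∈ FairMem.behDecl (fun G => G.TSO ∧ G.Fair) → β.Finite) ∧
        (β ∈ FairMem.behDecl (fun G => G.RA ∧ G.Fair) → β.Finite)) ∧
    -- with the release fence, under fair RC11
    (∀ β : FairMem.Behavior FairMem.Mode FairMem.Mode,
      β ∈ (FairMem.mcsClient true a b).behTF →
        β ∈ FairMem.behDecl (fun G => G.RC11 ∧ G.Fair) → β.Finite) ∧
    -- without the release fence, some thread-fair behavior under fair RC11 is infinite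
    (∃ β : FairMem.Behavior FairMem.Mode FairMem.Mode,
      β ∈ (FairMem.mcsClient false a b).behTF ∧
        β ∈ FairMem.behDecl (fun G => G.RC11 ∧ G.Fair) ∧ ¬ β.Finite) := by
  refine ⟨fun i β h => ⟨?_, ?_, ?_⟩, fun β h => FairMem.finite_of_RC11 ha hb hab h,
    FairMem.Unfenced.behavior a b, FairMem.Unfenced.behavior_mem_behTF ha hb,
    ⟨(FairMem.Unfenced.isPosition hab).graph,
      ⟨FairMem.Unfenced.rc11 hab, FairMem.Unfenced.fair hab⟩, rfl⟩,
    FairMem.Unfenced.not_finite_behavior⟩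
  · exact FairMem.finite_of_plain ha hb hab h fun _ => FairMem.ExecGraph.SC.coherent
  · exact FairMem.finite_of_plain ha hb hab h fun _ => FairMem.ExecGraph.TSO.coherent
  · exact FairMem.finite_of_plain ha hb hab h fun _ => FairMem.ExecGraph.RA.coherent
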